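/- **Setting.** Let $T$ be a rooted full binary tree with leaf set $\mathcal L$, and let $w$ be a weight function on its vertices with $w(x)=0$ for every leaf $x$ and $w(v)<w(p(v))$ for every non-root vertex $v$ with parent $p(v)$. The leaves form a metric space with distance $\delta(x,y)=w(\mathrm{lca}(x,y))$ (and $\delta(x,x)=0$). For $\alpha>1$, $(T,w)$ is an *$\alpha$-HSBT* if $w(p(v))\ge\alpha\, w(v)$ for every non-root vertex $v$; it is $n$-point if $|\mathcal L|=n$. *Min-cost perfect matching with delays.* An input $R$ is a finite set of evenly many requests $\rho$, each with a location $\ell(\rho)\in\mathcal L$ and an arrival time $t(\rho)\ge 0$; the arrival times are distinct. The requests have to be partitioned into pairs, each pair $\{\rho,\rho'\}$ being matched at a time $t\ge\max\{t(\rho),t(\rho')\}$ at cost $(t-t(\rho))+(t-t(\rho'))+\delta(\ell(\rho),\ell(\rho'))$. The cost of a matching is the sum over its pairs, and $\mathrm{OPT}(R)$ is the optimal offline cost. *The deterministic stilt-walker algorithm $\mathcal A_d$.* A request is active from its arrival until it is matched. A vertex is odd if the number of active requests at leaves of its subtree is odd. An internal vertex $v$ is effective if both its children are odd; from each child one then descends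 through odd vertices to a leaf, and the active requests at these two leaves are the supporting requests of $v$. If a request arrives at a leaf that hosts an active request, $\mathcal A_d$ matches the two at once (so each leaf hosts at most one active request). In addition each internal vertex $v$ has a deterministic $w(v)$-timer, which runs exactly while $v$ is effective (and keeps its value while $v$ is not effective): if $\mathcal A_d$ last matched across $v$ at time $t_0$ (with $t_0=0$ if it has not done so yet), then it next matches the supporting requests of $v$ at the first time $t_1$ at which the total time in $[t_0,t_1]$ during which $v$ was effective equals $w(v)$. *Competitive ratio.* $\mathcal A_d$ is $\rho$-competitive on a class of HSBTs if for every $\mathcal T$ in the class there is $\beta=\beta(\mathcal T)$ such that $\mathrm{cost}_{\mathcal A_d}(R)\le\rho\cdot\mathrm{OPT}(R)+\beta$ for all inputs $R$ over $\mathcal T$. Its competitive ratio on the class is the infimum of all real $\rho$ for which it is $\rho$-competitive ($+\infty$ if there are none). **Theorem.** The competitive ratio of $\mathcal A_d$ on $n$-point $(1+\Omega(1/\log n))$-HSBTs is $\Omega(n)$. That is, for every constant $\kappa>0$ there is a constant $c>0$ such that for every integer $n\ge 2$ the competitive ratio of $\mathcal A_d$ on the class of all $n$-point $(1+\kappa/\log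 n)$-HSBTs is at least $c\,n$ (where $\log$ is the natural logarithm). -/

import Mathlib

noncomputable section

namespace StiltWalker

/-! ### Hierarchically well separated binary trees

A pair `(T, w)` with `T` a full binary tree and `w` a weight function vanishing on the leaves is
encoded as a `BinaryTree ℝ`: `nil` is a leaf, `node w l r` is an internal vertex of weight `w` with
children `l` and `r`. -/

/-- The leaves of `T`, i.e. the points of the tree metric space. -/
inductive Leaf : BinaryTree ℝ → Type
  | here : Leaf .nil
  | left {w : ℝ} {l r : BinaryTree ℝ} : Leaf l → Leaf (.node w l r)
  | right {w : ℝ} {l r : BinaryTree ℝ} : Leaf r → Leaf (.node w l r)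

/-- The internal vertices of `T`: the root, if it is not a leaf, and the internal vertices of the
two subtrees. -/
inductive Inner : BinaryTree ℝ → Type
  | root {w : ℝ} {l r : BinaryTree ℝ} : Inner (.node w l r)
  | left {w : ℝ} {l r : BinaryTree ℝ} : Inner l → Inner (.node w l r)
  | right {w : ℝ} {l r : BinaryTree ℝ} : Inner r → Inner (.node w l r)

@[simp]
theorem Leaf.left_inj {w : ℝ} {l r : BinaryTree ℝ} {x y : Leaf l} :
    (Leaf.left x : Leaf (.node w l r)) = .left y ↔ x = y :=
  ⟨fun h => by cases h; rfl, fun h => h ▸ rfl⟩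

@[simp]
theorem Leaf.right_inj {w : ℝ} {l r : BinaryTree ℝ} {x y : Leaf r} :
    (Leaf.right x : Leaf (.node w l r)) = .right y ↔ x = y :=
  ⟨fun h => by cases h; rfl, fun h => h ▸ rfl⟩

def Leaf.nilEquiv : Unit ≃ Leaf .nil where
  toFun _ := .here
  invFun _ := ()
  left_inv _ := rfl
  right_inv | .here => rfl

def Leaf.nodeEquiv {w : ℝ} {l r : BinaryTree ℝ} : Leaf l ⊕ Leaf r ≃ Leaf (.node w l r) where
  toFun := Sum.elim .left .right
  invFun | .left x => .inl x | .right x => .inr x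
  left_inv := by rintro (x | x) <;> rfl
  right_inv := by rintro (_ | _ | _) <;> rfl

def Inner.nodeEquiv {w : ℝ} {l r : BinaryTree ℝ} :
    Option (Inner l ⊕ Inner r) ≃ Inner (.node w l r) where
  toFun v := v.elim .root (Sum.elim .left .right)
  invFun | .root => none | .left x => some (.inl x) | .right x => some (.inr x)
  left_inv := by rintro (_ | x | x) <;> rfl
  right_inv := by rintro (_ | _ | _) <;> rfl

instance Leaf.fintype : (T : BinaryTree ℝ) → Fintype (Leaf T)
  | .nil => .ofEquiv _ Leaf.nilEquiv
  | .node _ l r =>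
    letI := Leaf.fintype l
    letI := Leaf.fintype r
    .ofEquiv _ Leaf.nodeEquiv

instance Inner.fintype : (T : BinaryTree ℝ) → Fintype (Inner T)
  | .nil => ⟨∅, nofun⟩
  | .node _ l r =>
    letI := Inner.fintype l
    letI := Inner.fintype r
    .ofEquiv _ Inner.nodeEquiv

instance (T : BinaryTree ℝ) : DecidableEq (Leaf T) := Classical.decEq _

/-- The weight of an internal vertex. -/
def weight : {T : BinaryTree ℝ} → Inner T → ℝ
  | .node w _ _, .root => w
  | _, .left v => weight v
  | _, .right v => weight v

/-- The weight of the root; it is `0` if the root is a leaf. -/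
def rootWeight : BinaryTree ℝ → ℝ
  | .nil => 0
  | .node w _ _ => w

/-- The distance between two leaves: the weight of their least common ancestor. -/
def leafDist : {T : BinaryTree ℝ} → Leaf T → Leaf T → ℝ
  | _, .here, .here => 0
  | _, .left x, .left y => leafDist x y
  | _, .right x, .right y => leafDist x y
  | .node w _ _, .left _, .right _ => w
  | .node w _ _, .right _, .left _ => w

/-- `T` is an `α`-HSBT: every vertex `u` other than the root, with parent `p`, satisfies
`w u < w p` and `α * w u ≤ w p`. -/
def IsHSBT (α : ℝ) : BinaryTree ℝ → Prop
  | .nil => True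
  | .node w l r =>
    (rootWeight l < w ∧ α * rootWeight l ≤ w) ∧ (rootWeight r < w ∧ α * rootWeight r ≤ w) ∧
      IsHSBT α l ∧ IsHSBT α r

/-! ### Min-cost perfect matching with delays (MPMD) -/

/-- A request, given by its location and arrival time. -/
@[ext]
structure Request (T : BinaryTree ℝ) where
  loc : Leaf T
  arrival : ℝ

/-- The operation of matching the requests `fst` and `snd` at time `time`. -/
@[ext]
structure MatchOp (T : BinaryTree ℝ) where
  fst : Request T
  snd : Request T
  time : ℝ

/-- The time cost plus the space cost that a matching operation incurs for its two requests. -/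
def MatchOp.cost {T : BinaryTree ℝ} (e : MatchOp T) : ℝ :=
  (e.time - e.fst.arrival) + (e.time - e.snd.arrival) + leafDist e.fst.loc e.snd.loc

/-- The total cost of a collection of matching operations. -/
def cost {T : BinaryTree ℝ} (M : Multiset (MatchOp T)) : ℝ := (M.map MatchOp.cost).sum

/-- An MPMD input: an even number of requests with distinct nonnegative arrival times, listed in
order of arrival. -/
structure IsInput {T : BinaryTree ℝ} (R : List (Request T)) : Prop where
  sorted : R.Pairwise fun ρ ρ' => ρ.arrival < ρ'.arrival
  nonneg : ∀ ρ ∈ R, 0 ≤ ρ.arrival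
  even : Even R.length

/-- `M` is a perfect matching of the requests `R` with delays: each request is matched exactly once
and no request is matched before its arrival. -/
def IsMatching {T : BinaryTree ℝ} (R : List (Request T)) (M : Multiset (MatchOp T)) : Prop :=
  (M.bind fun e => {e.fst, e.snd}) = (R : Multiset (Request T)) ∧
    ∀ e ∈ M, e.fst.arrival ≤ e.time ∧ e.snd.arrival ≤ e.time

/-- The cost of an optimal offline algorithm on `R`. -/
def opt {T : BinaryTree ℝ} (R : List (Request T)) : ℝ := sInf (cost '' {M | IsMatching R M})

/-! ### Odd vertices, stilts and effective vertices

A configuration `a : Leaf T → Option ℝ` gives for each leaf the arrival time of the active request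
that it hosts, if there is one. -/

/-- The foot of the stilt through the root of `T`; there is such a stilt iff the root is odd. -/
def foot : {T : BinaryTree ℝ} → (Leaf T → Option ℝ) → Option (Leaf T)
  | .nil, a => (a .here).map fun _ => .here
  | .node _ _ _, a =>
    match foot fun x => a (.left x), foot fun x => a (.right x) with
    | some x, none => some (.left x)
    | none, some y => some (.right y)
    | _, _ => none

/-- The supporting leaves of the internal vertex `v`; `none` if `v` is not effective. The root is
effective iff its two children are odd. -/
def support : {T : BinaryTree ℝ} → (Leaf T → Option ℝ) → Inner T → Option (Leaf T × Leaf T)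
  | .node _ _ _, a, .root =>
    match foot fun x => a (.left x), foot fun x => a (.right x) with
    | some x, some y => some (.left x, .right y)
    | _, _ => none
  | _, a, .left v => (support (fun x => a (.left x)) v).map fun p => (.left p.1, .left p.2)
  | _, a, .right v => (support (fun x => a (.right x)) v).map fun p => (.right p.1, .right p.2)

/-- The root is odd iff there is a stilt through it. -/
theorem isSome_foot_iff {T : BinaryTree ℝ} (a : Leaf T → Option ℝ) :
    (foot a).isSome ↔ Odd (Nat.card {x // (a x).isSome}) := by
  induction T with
  | nil =>
    rcases h : a .here with _ | t
    · have : IsEmpty {x // (a x).isSome} := ⟨fun ⟨x, hx⟩ => by cases x; simp [h] at hx⟩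
      simp [foot, h]
    · have : Unique {x // (a x).isSome} :=
        ⟨⟨⟨.here, by simp [h]⟩⟩, fun ⟨x, _⟩ => by cases x; rfl⟩
      simp [foot, h]
  | node w l r ihl ihr =>
    have hc : Nat.card {x : Leaf (.node w l r) // (a x).isSome} =
        Nat.card {x : Leaf l // (a (.left x)).isSome} +
          Nat.card {x : Leaf r // (a (.right x)).isSome} := by
      rw [← Nat.card_sum]
      refine Nat.card_congr ((Leaf.nodeEquiv.subtypeEquiv fun x => Iff.rfl).symm.trans
        (Equiv.subtypeSum (p := fun x => (a (Leaf.nodeEquiv x)).isSome)))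
    rw [hc, Nat.odd_add, ← Nat.not_odd_iff_even, ← ihl, ← ihr]
    rw [foot]
    rcases foot _ with _ | x <;> rcases foot _ with _ | y <;> simp

/-- The configuration after the active requests at `x` and `y` have been matched. -/
def clear {T : BinaryTree ℝ} (a : Leaf T → Option ℝ) (x y : Leaf T) : Leaf T → Option ℝ :=
  fun z => if z = x ∨ z = y then none else a z

section clear

variable {w : ℝ} {l r : BinaryTree ℝ} (a : Leaf (.node w l r) → Option ℝ)

theorem clear_left_left (x y : Leaf l) :
    (fun z => clear a (.left x) (.left y) (.left z)) = clear (fun z => a (.left z)) x y := by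
  funext z; simp [clear]

theorem clear_left_right (x y : Leaf l) :
    (fun z => clear a (.left x) (.left y) (.right z)) = fun z => a (.right z) := by
  funext z; simp [clear]

theorem clear_right_left (x y : Leaf r) :
    (fun z => clear a (.right x) (.right y) (.left z)) = fun z => a (.left z) := by
  funext z; simp [clear]

theorem clear_right_right (x y : Leaf r) :
    (fun z => clear a (.right x) (.right y) (.right z)) = clear (fun z => a (.right z)) x y := by
  funext z; simp [clear]

theorem clear_mixed_left (x : Leaf l) (y : Leaf r) :
    (fun z => clear a (.left x) (.right y) (.left z)) = clear (fun z => a (.left z)) x x := by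
  funext z; simp [clear]

theorem clear_mixed_right (x : Leaf l) (y : Leaf r) :
    (fun z => clear a (.left x) (.right y) (.right z)) = clear (fun z => a (.right z)) y y := by
  funext z; simp [clear]

end clear

theorem foot_support_clear_foot {T : BinaryTree ℝ} {a : Leaf T → Option ℝ} {x : Leaf T}
    (h : foot a = some x) :
    foot (clear a x x) = none ∧ ∀ u, support (clear a x x) u = support a u := by
  induction T with
  | nil => cases x; exact ⟨by simp [foot, clear], fun u => nomatch u⟩
  | node w l r ihl ihr =>
    rw [foot] at h
    rcases hl : foot fun z => a (.left z) with _ | x' <;>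
      rcases hr : foot fun z => a (.right z) with _ | y' <;> simp only [hl, hr] at h
    · simp at h
    · cases h
      obtain ⟨h1, h2⟩ := ihr hr
      refine ⟨by simp [foot, clear_right_left, clear_right_right, h1, hl], ?_⟩
      rintro (_ | u | u) <;> simp [support, clear_right_left, clear_right_right, h1, h2, hl]
    · cases h
      obtain ⟨h1, h2⟩ := ihl hl
      refine ⟨by simp [foot, clear_left_left, clear_left_right, h1, hr], ?_⟩
      rintro (_ | u | u) <;> simp [support, clear_left_left, clear_left_right, h1, h2, hr]
    · simp at h

/-- Matching the supporting requests of `v` makes `v` not effective and affects neither the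
effectiveness nor the supporting leaves of any other vertex. -/
theorem support_clear {T : BinaryTree ℝ} {a : Leaf T → Option ℝ} {v : Inner T}
    {p : Leaf T × Leaf T} (h : support a v = some p) :
    foot (clear a p.1 p.2) = foot a ∧ support (clear a p.1 p.2) v = none ∧
      ∀ u, u ≠ v → support (clear a p.1 p.2) u = support a u := by
  induction T with
  | nil => exact nomatch v
  | node w l r ihl ihr =>
    cases v with
    | root =>
      rw [support] at h
      rcases hl : foot fun z => a (.left z) with _ | x <;>
        rcases hr : foot fun z => a (.right z) with _ | y <;> simp [hl, hr] at h
      subst h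
      obtain ⟨h1, h2⟩ := foot_support_clear_foot hl
      obtain ⟨h3, h4⟩ := foot_support_clear_foot hr
      refine ⟨by simp [foot, clear_mixed_left, clear_mixed_right, h1, h3, hl, hr],
        by simp [support, clear_mixed_left, clear_mixed_right, h1], ?_⟩
      rintro (_ | u | u) hu
      · exact absurd rfl hu
      · simp [support, clear_mixed_left, h2]
      · simp [support, clear_mixed_right, h4]
    | left v =>
      simp only [support, Option.map_eq_some_iff] at h
      obtain ⟨q, hq, rfl⟩ := h
      obtain ⟨h1, h2, h3⟩ := ihl hq
      refine ⟨by simp [foot, clear_left_left, clear_left_right, h1],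
        by simp [support, clear_left_left, h2], ?_⟩
      rintro (_ | u | u) hu
      · simp [support, clear_left_left, clear_left_right, h1]
      · simp [support, clear_left_left, h3 u (fun h => hu (h ▸ rfl))]
      · simp [support, clear_left_right]
    | right v =>
      simp only [support, Option.map_eq_some_iff] at h
      obtain ⟨q, hq, rfl⟩ := h
      obtain ⟨h1, h2, h3⟩ := ihr hq
      refine ⟨by simp [foot, clear_right_left, clear_right_right, h1],
        by simp [support, clear_right_right, h2], ?_⟩
      rintro (_ | u | u) hu
      · simp [support, clear_right_left, clear_right_right, h1]
      · simp [support, clear_right_left]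
      · simp [support, clear_right_right, h3 u (fun h => hu (h ▸ rfl))]

/-! ### The deterministic stilt-walker algorithm -/

/-- The state of the algorithm at time `clock`: the active requests, the amount of time `timer v`
during which the internal vertex `v` was effective since the last time the algorithm matched across
`v` (since time `0` if there was none), and the matching operations performed so far. -/
structure State (T : BinaryTree ℝ) where
  clock : ℝ
  active : Leaf T → Option ℝ
  timer : Inner T → ℝ
  matched : Multiset (MatchOp T)

variable {T : BinaryTree ℝ}

def State.init (T : BinaryTree ℝ) : State T := ⟨0, fun _ => none, fun _ => 0, 0⟩

/-- The time at which the timer of an effective vertex `v` reaches `w v`, if no request arrives. -/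
def State.expiry (σ : State T) (v : Inner T) : ℝ := σ.clock + (weight v - σ.timer v)

/-- The matching across `v` of its supporting requests when the timer of `v` expires, if no request
arrives before; `none` if `v` is not effective. -/
def State.pending (σ : State T) (v : Inner T) : Option (MatchOp T) :=
  (support σ.active v).bind fun p =>
    (σ.active p.1).bind fun t₁ => (σ.active p.2).map fun t₂ =>
      ⟨⟨p.1, t₁⟩, ⟨p.2, t₂⟩, σ.expiry v⟩

open Classical in
/-- The state at time `s`, if no request arrives after `σ.clock` and before `s`: the effective
vertices whose timer expires up to time `s` match their supporting requests upon expiry, and the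
timers of the other effective vertices proceed. (By `support_clear`, matching across `v`
makes `v` not effective and changes neither the effectiveness nor the supporting leaves of any other
vertex. Hence the effective vertices do not interact until the next arrival.) -/
def State.advance (σ : State T) (s : ℝ) : State T where
  clock := s
  active x :=
    if ∃ v, ∃ e ∈ σ.pending v, e.time ≤ s ∧ (x = e.fst.loc ∨ x = e.snd.loc) then none
    else σ.active x
  timer v :=
    match σ.pending v with
    | none => σ.timer v
    | some e => if e.time ≤ s then 0 else σ.timer v + (s - σ.clock)
  matched := σ.matched + ∑ v, match σ.pending v with
    | none => 0
    | some e => if e.time ≤ s then {e} else 0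

/-- The reaction to the arrival of `ρ`: it is matched at once if its location already hosts an
active request, otherwise it becomes active. -/
def State.arrive (σ : State T) (ρ : Request T) : State T :=
  match (σ.advance ρ.arrival).active ρ.loc with
  | some t =>
    { σ.advance ρ.arrival with
      active := Function.update (σ.advance ρ.arrival).active ρ.loc none
      matched := (σ.advance ρ.arrival).matched + {⟨⟨ρ.loc, t⟩, ρ, ρ.arrival⟩} }
  | none =>
    { σ.advance ρ.arrival with
      active := Function.update (σ.advance ρ.arrival).active ρ.loc (some ρ.arrival) }

/-- All matching operations when no further request arrives. -/
def State.finish (σ : State T) : Multiset (MatchOp T) :=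
  σ.matched + ∑ v, match σ.pending v with
    | none => 0
    | some e => {e}

/-- The matching operations that the deterministic stilt-walker algorithm performs on `R`. -/
def stiltWalk (R : List (Request T)) : Multiset (MatchOp T) :=
  (R.foldl State.arrive (State.init T)).finish

/-! ### Competitive ratio -/

/-- The deterministic stilt-walker algorithm is `ρ`-competitive on the class `C` of trees. -/
def IsCompetitiveOn (C : Set (BinaryTree ℝ)) (ρ : ℝ) : Prop :=
  ∀ T ∈ C, ∃ β : ℝ, ∀ R : List (Request T), IsInput R → cost (stiltWalk R) ≤ ρ * opt R + β

/-- The competitive ratio of the deterministic stilt-walker algorithm on the class `C` of trees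
(`⊤` if it is not `ρ`-competitive for any `ρ`). -/
def competitiveRatio (C : Set (BinaryTree ℝ)) : EReal :=
  sInf ((fun ρ : ℝ => (ρ : EReal)) '' {ρ | IsCompetitiveOn C ρ})

end StiltWalker

end

noncomputable section

namespace StiltWalker

/-! ### Supports and feet -/

/-! The lower bound rests on *sweeps*: short request sequences that make the algorithm match across
every internal vertex of a tree, while an offline matching pays little more than the weight of the
root. Sweeps can be repeated arbitrarily often, which absorbs the additive constant `β`, so the
competitive ratio is at least about the total weight divided by the root weight plus one
(`sum_weight_le_of_isCompetitiveOn`). In a balanced tree of root weight 1 whose weights shrink by `α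
= 1 + κ / log n` per level, the depth is about `log₂ n`, so `α` to the depth is bounded in terms of
`κ`. All `n - 1` internal vertices then have weight `Ω(1)`, and the total weight is `Ω(n)`.

A sweep is built recursively (`exists_sweep`). One request in each child makes the root effective.
Just before its timer expires, the same two leaves get new requests, which are matched at once with
the waiting ones; then one further request arrives in each child, at its second distinguished leaf,
and these two are matched across the root (`State.exists_swap`). Now the sweeps of both children
start. Each opens with requests at the two distinguished leaves of that child, exactly where the
last four requests arrived. Offline, these coincide in location and almost in time, so they are
matched almost for free and the weights of the children are never paid (`isMatching_interleave`).
Only the first two requests cost the root weight.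

The sweeps of the two children run simultaneously. They do not disturb each other because in a sweep
a tree is odd for a tiny total time only: the timer of the common parent cannot expire meanwhile,
and the two subtrees evolve independently (`Interleave.decomposes`). -/

theorem foot_active {T : BinaryTree ℝ} {a : Leaf T → Option ℝ} {x : Leaf T}
    (h : foot a = some x) : (a x).isSome := by
  induction T with
  | nil => cases x; simp only [foot, Option.map_eq_some_iff] at h; obtain ⟨t, ht, -⟩ := h; simp [ht]
  | node w l r ihl ihr =>
    rw [foot] at h
    rcases hl : foot fun z => a (.left z) with _ | x' <;>
      rcases hr : foot fun z => a (.right z) with _ | y' <;> simp only [hl, hr] at h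
    · simp at h
    · cases h; exact ihr hr
    · cases h; exact ihl hl
    · simp at h

theorem support_active {T : BinaryTree ℝ} {a : Leaf T → Option ℝ} {v : Inner T}
    {p : Leaf T × Leaf T} (h : support a v = some p) : (a p.1).isSome ∧ (a p.2).isSome := by
  induction T with
  | nil => exact nomatch v
  | node w l r ihl ihr =>
    cases v with
    | root =>
      rw [support] at h
      rcases hl : foot fun z => a (.left z) with _ | x <;>
        rcases hr : foot fun z => a (.right z) with _ | y <;> simp [hl, hr] at h
      subst h
      exact ⟨foot_active (a := fun z => a (.left z)) hl,
        foot_active (a := fun z => a (.right z)) hr⟩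
    | left v =>
      simp only [support, Option.map_eq_some_iff] at h
      obtain ⟨q, hq, rfl⟩ := h
      exact ihl hq
    | right v =>
      simp only [support, Option.map_eq_some_iff] at h
      obtain ⟨q, hq, rfl⟩ := h
      exact ihr hq

open Classical in
/-- The configuration after all vertices in `V` have matched their supporting requests. -/
def clearAll {T : BinaryTree ℝ} (a : Leaf T → Option ℝ) (V : Set (Inner T)) : Leaf T → Option ℝ :=
  fun x => if ∃ v ∈ V, ∃ p, support a v = some p ∧ (x = p.1 ∨ x = p.2) then none else a x

open Classical in
-- Effective vertices do not interact: by `support_clear` the set `V` can be processed one vertex at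
-- a time, each step leaving the remaining supports untouched.
theorem support_clearAll {T : BinaryTree ℝ} (a : Leaf T → Option ℝ) (V : Set (Inner T)) :
    foot (clearAll a V) = foot a ∧
      ∀ u, support (clearAll a V) u = if u ∈ V then none else support a u := by
  induction V, V.toFinite using Set.Finite.induction_on with
  | empty =>
    have : clearAll a ∅ = a := by funext x; simp [clearAll]
    simp [this]
  | @insert v V hv _ ih =>
    obtain ⟨ih1, ih2⟩ := ih
    rcases h : support a v with _ | p
    · have : clearAll a (insert v V) = clearAll a V := by
        funext x; simp [clearAll, h]
      rw [this]
      refine ⟨ih1, fun u => ?_⟩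
      rw [ih2]
      by_cases hu : u = v
      · subst hu; simp [h]
      · simp [hu]
    · have : clearAll a (insert v V) = clear (clearAll a V) p.1 p.2 := by
        funext x
        simp only [clearAll, clear, Set.mem_insert_iff, exists_eq_or_imp, h, Option.some.injEq,
          exists_eq_left']
        by_cases hx : x = p.1 ∨ x = p.2 <;> simp [hx]
      have hs : support (clearAll a V) v = some p := by rw [ih2, if_neg hv, h]
      obtain ⟨h1, h2, h3⟩ := support_clear hs
      rw [this]
      refine ⟨h1.trans ih1, fun u => ?_⟩
      by_cases hu : u = v
      · subst hu; simp [h2]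
      · simp [h3 u hu, ih2, hu]

/-- Switching one leaf between active and inactive flips the parity of exactly one child, hence of
the root. -/
theorem isSome_foot_update {T : BinaryTree ℝ} (a : Leaf T → Option ℝ) (x : Leaf T) (b : Option ℝ)
    (hb : b.isSome ↔ ¬ (a x).isSome) :
    (foot (Function.update a x b)).isSome ↔ ¬ (foot a).isSome := by
  induction T with
  | nil => cases x; simpa [foot] using hb
  | node w l r ihl ihr =>
    cases x with
    | left x =>
      have h1 : (fun z => Function.update a (.left x) b (.left z)) =
          Function.update (fun z => a (.left z)) x b := by
        funext z; simp [Function.update_apply]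
      have h2 : (fun z => Function.update a (.left x) b (.right z)) = fun z => a (.right z) := by
        funext z; simp
      have := ihl (fun z => a (.left z)) x hb
      clear ihl ihr hb
      simp only [foot, h1, h2]
      rcases h3 : foot (Function.update (fun z => a (.left z)) x b) with _ | _ <;>
        rcases h4 : foot (fun z => a (.left z)) with _ | _ <;>
        rcases h5 : foot (fun z => a (.right z)) with _ | _ <;> simp_all
    | right x =>
      have h1 : (fun z => Function.update a (.right x) b (.right z)) =
          Function.update (fun z => a (.right z)) x b := by
        funext z; simp [Function.update_apply]
      have h2 : (fun z => Function.update a (.right x) b (.left z)) = fun z => a (.left z) := by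
        funext z; simp
      have := ihr (fun z => a (.right z)) x hb
      clear ihl ihr hb
      simp only [foot, h1, h2]
      rcases h3 : foot (Function.update (fun z => a (.right z)) x b) with _ | _ <;>
        rcases h4 : foot (fun z => a (.left z)) with _ | _ <;>
        rcases h5 : foot (fun z => a (.right z)) with _ | _ <;> simp_all

/-! ### The evolution between arrivals -/

variable {T : BinaryTree ℝ}

theorem State.pending_eq_none_iff (σ : State T) (v : Inner T) :
    σ.pending v = none ↔ support σ.active v = none := by
  rcases h : support σ.active v with _ | p
  · simp [State.pending, h]
  · obtain ⟨h1, h2⟩ := support_active h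
    obtain ⟨t₁, h1⟩ := Option.isSome_iff_exists.1 h1
    obtain ⟨t₂, h2⟩ := Option.isSome_iff_exists.1 h2
    simp [State.pending, h, h1, h2]

theorem State.pending_eq_some {σ : State T} {v : Inner T} {e : MatchOp T}
    (h : σ.pending v = some e) :
    support σ.active v = some (e.fst.loc, e.snd.loc) ∧ σ.active e.fst.loc = some e.fst.arrival ∧
      σ.active e.snd.loc = some e.snd.arrival ∧ e.time = σ.expiry v := by
  simp only [State.pending, Option.bind_eq_some_iff, Option.map_eq_some_iff] at h
  obtain ⟨p, hp, t₁, h1, t₂, h2, rfl⟩ := h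
  exact ⟨hp, h1, h2, rfl⟩

theorem State.pending_eq_some_of {σ : State T} {v : Inner T} {p : Leaf T × Leaf T} {t₁ t₂ : ℝ}
    (h : support σ.active v = some p) (h₁ : σ.active p.1 = some t₁)
    (h₂ : σ.active p.2 = some t₂) :
    σ.pending v = some ⟨⟨p.1, t₁⟩, ⟨p.2, t₂⟩, σ.expiry v⟩ := by
  simp [State.pending, h, h₁, h₂]

theorem State.advance_active (σ : State T) (s : ℝ) :
    (σ.advance s).active =
      clearAll σ.active {v | ∃ e ∈ σ.pending v, e.time ≤ s} := by
  funext x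
  simp only [State.advance, clearAll, Set.mem_ofPred_eq]
  congr 1
  refine propext ⟨?_, ?_⟩
  · rintro ⟨v, e, he, hs, hx⟩
    exact ⟨v, ⟨e, he, hs⟩, _, (State.pending_eq_some he).1, hx⟩
  · rintro ⟨v, ⟨e, he, hs⟩, p, hp, hx⟩
    rw [(State.pending_eq_some he).1] at hp
    cases hp
    exact ⟨v, e, he, hs, hx⟩

theorem State.foot_advance (σ : State T) (s : ℝ) :
    foot (σ.advance s).active = foot σ.active := by
  rw [σ.advance_active, (support_clearAll _ _).1]

theorem State.advance_active_of_mem {σ : State T} {s : ℝ} {v : Inner T} {p : Leaf T × Leaf T}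
    (h : support (σ.advance s).active v = some p) :
    (σ.advance s).active p.1 = σ.active p.1 ∧ (σ.advance s).active p.2 = σ.active p.2 := by
  have := support_active h
  rw [σ.advance_active] at this ⊢
  simp only [clearAll] at this ⊢
  split_ifs at this ⊢ <;> simp_all

/-- Clock and running timer grow at the same rate, so the expiry time of a vertex that has not fired
is invariant. -/
theorem State.pending_advance (σ : State T) (s : ℝ) (v : Inner T) :
    (σ.advance s).pending v = (σ.pending v).filter fun e => s < e.time := by
  classical
  have hsup : support (σ.advance s).active v =
      if ∃ e ∈ σ.pending v, e.time ≤ s then none else support σ.active v := by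
    rw [σ.advance_active, (support_clearAll _ _).2]; congr
  rcases h : σ.pending v with _ | e
  · rw [Option.filter_none, State.pending_eq_none_iff, hsup, (σ.pending_eq_none_iff v).1 h]
    simp
  · obtain ⟨h1, h2, h3, h4⟩ := State.pending_eq_some h
    by_cases hs : e.time ≤ s
    · rw [Option.filter_some_neg (by simpa using hs), State.pending_eq_none_iff, hsup,
        if_pos ⟨e, h, hs⟩]
    · rw [Option.filter_some_pos (by simpa using hs)]
      rw [if_neg (by simpa [h] using hs), h1] at hsup
      obtain ⟨h5, h6⟩ := State.advance_active_of_mem hsup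
      rw [State.pending_eq_some_of hsup (h5.trans h2) (h6.trans h3)]
      have : (σ.advance s).expiry v = e.time := by
        rw [h4]
        simp only [State.expiry, State.advance, h, if_neg hs]
        ring
      rw [this]

theorem State.eq_of {σ σ' : State T} (h₁ : σ.clock = σ'.clock)
    (h₂ : ∀ x, σ.active x = σ'.active x) (h₃ : ∀ v, σ.timer v = σ'.timer v)
    (h₄ : σ.matched = σ'.matched) : σ = σ' := by
  cases σ; cases σ'
  simp_all [funext_iff]

/-- Semigroup property of the evolution. It allows intermediate stops, such as those forced on one
subtree by an arrival in the other. -/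
theorem State.advance_advance (σ : State T) {s s' : ℝ} (h : s ≤ s') :
    (σ.advance s).advance s' = σ.advance s' := by
  have hp := σ.pending_advance s
  refine State.eq_of rfl (fun x => ?_) (fun v => ?_) ?_
  · simp only [State.advance.eq_def (σ.advance s), hp]
    simp only [State.advance]
    by_cases h1 : ∃ v, ∃ e ∈ σ.pending v, e.time ≤ s ∧ (x = e.fst.loc ∨ x = e.snd.loc)
    · have h2 : ∃ v, ∃ e ∈ σ.pending v, e.time ≤ s' ∧ (x = e.fst.loc ∨ x = e.snd.loc) := by
        obtain ⟨v, e, he, hs, hx⟩ := h1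
        exact ⟨v, e, he, hs.trans h, hx⟩
      rw [if_pos h1, if_pos h2, ite_self]
    · rw [if_neg h1]
      congr 1
      refine propext ⟨?_, ?_⟩
      · rintro ⟨v, e, he, hx⟩
        exact ⟨v, e, (Option.mem_filter_iff.1 he).1, hx⟩
      · rintro ⟨v, e, he, hs, hx⟩
        refine ⟨v, e, Option.mem_filter_iff.2 ⟨he, ?_⟩, hs, hx⟩
        simp only [decide_eq_true_eq]
        by_contra hc
        exact h1 ⟨v, e, he, not_lt.1 hc, hx⟩
  · simp only [State.advance.eq_def (σ.advance s), hp]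
    simp only [State.advance]
    rcases σ.pending v with _ | e
    · simp
    · by_cases h1 : e.time ≤ s
      · have hf : (some e).filter (fun e => decide (s < e.time)) = none :=
          Option.filter_some_neg (by simpa using h1)
        simp [hf, h1, h1.trans h]
      · have hf : (some e).filter (fun e => decide (s < e.time)) = some e :=
          Option.filter_some_pos (by simpa using h1)
        simp only [hf, h1, if_false]
        split_ifs <;> ring
  · simp only [State.advance.eq_def (σ.advance s), hp]
    simp only [State.advance]
    rw [add_assoc, ← Finset.sum_add_distrib]
    congr 1
    refine Finset.sum_congr rfl fun v _ => ?_
    rcases σ.pending v with _ | e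
    · simp
    · by_cases h1 : e.time ≤ s
      · have hf : (some e).filter (fun e => decide (s < e.time)) = none :=
          Option.filter_some_neg (by simpa using h1)
        simp [hf, h1, h1.trans h]
      · have hf : (some e).filter (fun e => decide (s < e.time)) = some e :=
          Option.filter_some_pos (by simpa using h1)
        simp [hf, h1]

theorem State.arrive_advance (σ : State T) {s : ℝ} {ρ : Request T} (h : s ≤ ρ.arrival) :
    (σ.advance s).arrive ρ = σ.arrive ρ := by
  simp only [State.arrive, σ.advance_advance h]

theorem State.advance_foldl_advance (σ : State T) {s e : ℝ} (R : List (Request T))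
    (hR : ∀ ρ ∈ R, s ≤ ρ.arrival) (he : s ≤ e) :
    (R.foldl State.arrive (σ.advance s)).advance e = (R.foldl State.arrive σ).advance e := by
  cases R with
  | nil => exact σ.advance_advance he
  | cons ρ R => rw [List.foldl_cons, List.foldl_cons, σ.arrive_advance (hR ρ (by simp))]

theorem State.clock_arrive (σ : State T) (ρ : Request T) :
    (σ.arrive ρ).clock = ρ.arrival := by
  rw [State.arrive]
  split <;> rfl

/-- Matchings remove requests in pairs, so only arrivals change the parity of the root. Its odd
times therefore depend on the input alone, not on the behaviour of the algorithm. -/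
theorem State.foot_arrive (σ : State T) (ρ : Request T) :
    (foot (σ.arrive ρ).active).isSome ↔ ¬ (foot σ.active).isSome := by
  rw [← σ.foot_advance ρ.arrival, State.arrive]
  split <;> rename_i h <;> exact isSome_foot_update _ _ _ (by simp [h])

/-- If nothing is active at time `e`, every pending matching has already been performed by then. -/
theorem State.finish_of_advance_active {σ : State T} {e : ℝ}
    (h : (σ.advance e).active = fun _ => none) : σ.finish = (σ.advance e).matched := by
  simp only [State.finish, State.advance]
  congr 1
  refine Finset.sum_congr rfl fun v _ => ?_
  have h1 := σ.pending_advance e v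
  have h2 : (σ.advance e).pending v = none := by
    rcases h3 : (σ.advance e).pending v with _ | p
    · rfl
    · have := (State.pending_eq_some h3).2.1
      simp [h] at this
  rw [h2] at h1
  rcases h3 : σ.pending v with _ | p
  · rfl
  · rw [h3] at h1
    by_cases h4 : p.time ≤ e
    · simp [h4]
    · simp [Option.filter, not_le.1 h4] at h1

end StiltWalker

end

noncomputable section

namespace StiltWalker

/-! ### The two subtrees of a vertex -/

theorem Inner.exists_node {w : ℝ} {l r : BinaryTree ℝ} {p : Inner (.node w l r) → Prop} :
    (∃ v, p v) ↔ p .root ∨ (∃ v, p (.left v)) ∨ ∃ v, p (.right v) := by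
  constructor
  · rintro ⟨_ | v | v, h⟩
    · exact .inl h
    · exact .inr (.inl ⟨v, h⟩)
    · exact .inr (.inr ⟨v, h⟩)
  · rintro (h | ⟨v, h⟩ | ⟨v, h⟩) <;> exact ⟨_, h⟩

theorem Inner.sum_node {M : Type*} [AddCommMonoid M] {w : ℝ} {l r : BinaryTree ℝ}
    (f : Inner (.node w l r) → M) :
    ∑ v, f v = f .root + (∑ v, f (.left v) + ∑ v, f (.right v)) := by
  rw [← Equiv.sum_comp Inner.nodeEquiv f, Fintype.sum_option, Fintype.sum_sum_type]
  rfl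

theorem cost_zero {T : BinaryTree ℝ} : cost (0 : Multiset (MatchOp T)) = 0 := by simp [cost]

theorem cost_add {T : BinaryTree ℝ} (M N : Multiset (MatchOp T)) :
    cost (M + N) = cost M + cost N := by simp [cost]

theorem cost_singleton {T : BinaryTree ℝ} (e : MatchOp T) : cost {e} = e.cost := by simp [cost]

theorem cost_sum {T : BinaryTree ℝ} {ι : Type*} (s : Finset ι) (f : ι → Multiset (MatchOp T)) :
    cost (∑ i ∈ s, f i) = ∑ i ∈ s, cost (f i) := by
  classical
  induction s using Finset.induction_on with
  | empty => simp [cost_zero]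
  | insert i s hi ih => rw [Finset.sum_insert hi, Finset.sum_insert hi, cost_add, ih]

/-- The matching operations across `v` up to time `s`, if no request arrives before. -/
def State.firing {T : BinaryTree ℝ} (σ : State T) (s : ℝ) (v : Inner T) : Multiset (MatchOp T) :=
  open Classical in
  match σ.pending v with
  | none => 0
  | some e => if e.time ≤ s then {e} else 0

theorem State.matched_advance {T : BinaryTree ℝ} (σ : State T) (s : ℝ) :
    (σ.advance s).matched = σ.matched + ∑ v, σ.firing s v := rfl

section embed

variable {w : ℝ} {l r : BinaryTree ℝ}

/-- A request in the left subtree as a request in the tree. -/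
def Request.inl (ρ : Request l) : Request (.node w l r) := ⟨.left ρ.loc, ρ.arrival⟩

/-- A request in the right subtree as a request in the tree. -/
def Request.inr (ρ : Request r) : Request (.node w l r) := ⟨.right ρ.loc, ρ.arrival⟩

/-- A matching operation in the left subtree as a matching operation in the tree. -/
def MatchOp.inl (e : MatchOp l) : MatchOp (.node w l r) := ⟨e.fst.inl, e.snd.inl, e.time⟩

/-- A matching operation in the right subtree as a matching operation in the tree. -/
def MatchOp.inr (e : MatchOp r) : MatchOp (.node w l r) := ⟨e.fst.inr, e.snd.inr, e.time⟩

theorem MatchOp.cost_inl (e : MatchOp l) : (e.inl : MatchOp (.node w l r)).cost = e.cost := by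
  simp [MatchOp.cost, MatchOp.inl, Request.inl, leafDist]

theorem MatchOp.cost_inr (e : MatchOp r) : (e.inr : MatchOp (.node w l r)).cost = e.cost := by
  simp [MatchOp.cost, MatchOp.inr, Request.inr, leafDist]

theorem cost_map_inl (M : Multiset (MatchOp l)) :
    cost (M.map MatchOp.inl : Multiset (MatchOp (.node w l r))) = cost M := by
  simp [cost, MatchOp.cost_inl]

theorem cost_map_inr (M : Multiset (MatchOp r)) :
    cost (M.map MatchOp.inr : Multiset (MatchOp (.node w l r))) = cost M := by
  simp [cost, MatchOp.cost_inr]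

/-- The state `σ` of the tree restricts to the states `σl` and `σr` of the two subtrees, up to the
cost `K` that accounts for the past. -/
structure Decomposes (σ : State (.node w l r)) (σl : State l) (σr : State r) (K : ℝ) : Prop where
  clock_left : σl.clock = σ.clock
  clock_right : σr.clock = σ.clock
  active_left : ∀ x, σl.active x = σ.active (.left x)
  active_right : ∀ x, σr.active x = σ.active (.right x)
  timer_left : ∀ v, σl.timer v = σ.timer (.left v)
  timer_right : ∀ v, σr.timer v = σ.timer (.right v)
  cost_eq : cost σ.matched = K + cost σl.matched + cost σr.matched

variable {σ : State (.node w l r)} {σl : State l} {σr : State r} {K : ℝ}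

theorem Decomposes.pending_left (h : Decomposes σ σl σr K) (v : Inner l) :
    σ.pending (.left v) = (σl.pending v).map MatchOp.inl := by
  have ha : (fun x => σ.active (.left x)) = σl.active := funext fun x => (h.active_left x).symm
  have he : σ.expiry (.left v) = σl.expiry v := by
    simp [State.expiry, h.clock_left, h.timer_left, weight]
  simp only [State.pending, support, ha, he]
  rcases support σl.active v with _ | p
  · rfl
  · simp only [Option.map_some, Option.bind_some, ← h.active_left]
    rcases σl.active p.1 with _ | t₁
    · rfl
    · rcases σl.active p.2 with _ | t₂ <;> rfl

theorem Decomposes.pending_right (h : Decomposes σ σl σr K) (v : Inner r) :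
    σ.pending (.right v) = (σr.pending v).map MatchOp.inr := by
  have ha : (fun x => σ.active (.right x)) = σr.active := funext fun x => (h.active_right x).symm
  have he : σ.expiry (.right v) = σr.expiry v := by
    simp [State.expiry, h.clock_right, h.timer_right, weight]
  simp only [State.pending, support, ha, he]
  rcases support σr.active v with _ | p
  · rfl
  · simp only [Option.map_some, Option.bind_some, ← h.active_right]
    rcases σr.active p.1 with _ | t₁
    · rfl
    · rcases σr.active p.2 with _ | t₂ <;> rfl

/-- As long as the root does not match, the two subtrees evolve independently. -/
theorem Decomposes.advance (h : Decomposes σ σl σr K) {s : ℝ}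
    (hs : ∀ e ∈ σ.pending .root, s < e.time) :
    Decomposes (σ.advance s) (σl.advance s) (σr.advance s) K where
  clock_left := rfl
  clock_right := rfl
  active_left x := by
    simp only [State.advance, ← h.active_left]
    congr 1
    refine propext ?_
    rw [Inner.exists_node]
    simp only [h.pending_left, h.pending_right, Option.mem_def, Option.map_eq_some_iff]
    constructor
    · rintro ⟨v, e, he, hx⟩
      exact .inr (.inl ⟨v, e.inl, ⟨e, he, rfl⟩, by simpa [MatchOp.inl, Request.inl] using hx⟩)
    · rintro (⟨e, he, hx, -⟩ | ⟨v, _, ⟨e, he, rfl⟩, hx⟩ | ⟨v, _, ⟨e, he, rfl⟩, hx⟩)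
      · exact absurd hx (not_le.2 (hs e he))
      · exact ⟨v, e, he, by simpa [MatchOp.inl, Request.inl] using hx⟩
      · simp [MatchOp.inr, Request.inr] at hx
  active_right x := by
    simp only [State.advance, ← h.active_right]
    congr 1
    refine propext ?_
    rw [Inner.exists_node]
    simp only [h.pending_left, h.pending_right, Option.mem_def, Option.map_eq_some_iff]
    constructor
    · rintro ⟨v, e, he, hx⟩
      exact .inr (.inr ⟨v, e.inr, ⟨e, he, rfl⟩, by simpa [MatchOp.inr, Request.inr] using hx⟩)
    · rintro (⟨e, he, hx, -⟩ | ⟨v, _, ⟨e, he, rfl⟩, hx⟩ | ⟨v, _, ⟨e, he, rfl⟩, hx⟩)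
      · exact absurd hx (not_le.2 (hs e he))
      · simp [MatchOp.inl, Request.inl] at hx
      · exact ⟨v, e, he, by simpa [MatchOp.inr, Request.inr] using hx⟩
  timer_left v := by
    simp only [State.advance, h.pending_left, h.timer_left, h.clock_left]
    rcases σl.pending v with _ | e <;> rfl
  timer_right v := by
    simp only [State.advance, h.pending_right, h.timer_right, h.clock_right]
    rcases σr.pending v with _ | e <;> rfl
  cost_eq := by
    have hroot : σ.firing s .root = 0 := by
      rcases he : σ.pending .root with _ | e
      · simp [State.firing, he]
      · simp [State.firing, he, hs e he]
    have hl : ∀ v, cost (σ.firing s (.left v)) = cost (σl.firing s v) := fun v => by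
      rw [State.firing, State.firing, h.pending_left]
      rcases σl.pending v with _ | e
      · simp [cost_zero]
      · by_cases ht : e.time ≤ s <;>
          simp [MatchOp.inl, ht, cost_zero, cost_singleton, ← MatchOp.cost_inl (w := w) (r := r) e]
    have hr : ∀ v, cost (σ.firing s (.right v)) = cost (σr.firing s v) := fun v => by
      rw [State.firing, State.firing, h.pending_right]
      rcases σr.pending v with _ | e
      · simp [cost_zero]
      · by_cases ht : e.time ≤ s <;>
          simp [MatchOp.inr, ht, cost_zero, cost_singleton, ← MatchOp.cost_inr (w := w) (l := l) e]
    simp only [State.matched_advance, Inner.sum_node, hroot, zero_add, cost_add, cost_sum,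
      h.cost_eq, hl, hr]
    ring

/-- Whether a request is matched at once depends on its leaf only, so the other subtree just sees
time pass. -/
theorem Decomposes.arrive_left (h : Decomposes σ σl σr K) {ρ : Request l}
    (hs : ∀ e ∈ σ.pending .root, ρ.arrival < e.time) :
    Decomposes (σ.arrive ρ.inl) (σl.arrive ρ) (σr.advance ρ.arrival) K := by
  have ha := h.advance hs
  have hx := ha.active_left ρ.loc
  simp only [State.arrive, Request.inl]
  rcases hl : (σl.advance ρ.arrival).active ρ.loc with _ | t
  · rw [hl] at hx
    simp only [← hx]
    exact ⟨rfl, rfl, fun x => by simp [Function.update_apply, ha.active_left],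
      fun x => by simp [ha.active_right], ha.timer_left, ha.timer_right, ha.cost_eq⟩
  · rw [hl] at hx
    simp only [← hx]
    refine ⟨rfl, rfl, fun x => by simp [Function.update_apply, ha.active_left],
      fun x => by simp [ha.active_right], ha.timer_left, ha.timer_right, ?_⟩
    simp only [cost_add, cost_singleton, ha.cost_eq, MatchOp.cost, leafDist]
    ring

theorem Decomposes.arrive_right (h : Decomposes σ σl σr K) {ρ : Request r}
    (hs : ∀ e ∈ σ.pending .root, ρ.arrival < e.time) :
    Decomposes (σ.arrive ρ.inr) (σl.advance ρ.arrival) (σr.arrive ρ) K := by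
  have ha := h.advance hs
  have hx := ha.active_right ρ.loc
  simp only [State.arrive, Request.inr]
  rcases hl : (σr.advance ρ.arrival).active ρ.loc with _ | t
  · rw [hl] at hx
    simp only [← hx]
    exact ⟨rfl, rfl, fun x => by simp [ha.active_left],
      fun x => by simp [Function.update_apply, ha.active_right], ha.timer_left, ha.timer_right,
      ha.cost_eq⟩
  · rw [hl] at hx
    simp only [← hx]
    refine ⟨rfl, rfl, fun x => by simp [ha.active_left],
      fun x => by simp [Function.update_apply, ha.active_right], ha.timer_left, ha.timer_right, ?_⟩
    simp only [cost_add, cost_singleton, ha.cost_eq, MatchOp.cost, leafDist]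
    ring

/-- If the root is effective then its left child is odd. -/
theorem Decomposes.isSome_foot_left (h : Decomposes σ σl σr K) {e : MatchOp (.node w l r)}
    (he : e ∈ σ.pending .root) : (foot σl.active).isSome := by
  have h1 := (State.pending_eq_some he).1
  rw [support] at h1
  rw [show σl.active = fun x => σ.active (.left x) from funext h.active_left]
  rcases hl : foot (fun x => σ.active (.left x)) with _ | x
  · rcases hr : foot (fun x => σ.active (.right x)) with _ | y <;> simp [hl] at h1
  · rfl

end embed

end StiltWalker

end

noncomputable section

namespace StiltWalker

/-! ### Interleaved request sequences -/

/-- The times at which `k` plus the number of requests that have arrived is odd. -/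
def oddTimes {T : BinaryTree ℝ} (k : ℕ) (R : List (Request T)) : Set ℝ :=
  {s | Odd (k + R.countP fun ρ => ρ.arrival ≤ s)}

theorem mem_oddTimes {T : BinaryTree ℝ} {k : ℕ} {R : List (Request T)} {s : ℝ} :
    s ∈ oddTimes k R ↔ Odd (k + R.countP fun ρ => ρ.arrival ≤ s) := Iff.rfl

theorem mem_oddTimes_of_forall_lt {T : BinaryTree ℝ} {k : ℕ} {R : List (Request T)} {s : ℝ}
    (h : ∀ ρ ∈ R, s < ρ.arrival) : s ∈ oddTimes k R ↔ Odd k := by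
  rw [mem_oddTimes, List.countP_eq_zero.2 fun ρ hρ => by simpa using h ρ hρ, add_zero]

/-- The offset `k` absorbs requests that have already arrived, which suits an induction along the
input. -/
theorem mem_oddTimes_cons {T : BinaryTree ℝ} {k : ℕ} {ρ : Request T} {R : List (Request T)} {s : ℝ}
    (h : ρ.arrival ≤ s) : s ∈ oddTimes k (ρ :: R) ↔ s ∈ oddTimes (k + 1) R := by
  rw [mem_oddTimes, mem_oddTimes, List.countP_cons_of_pos (by simpa using h), add_assoc,
    add_comm 1]

variable {w : ℝ} {l r : BinaryTree ℝ}

/-- The third list is obtained by interleaving the first two. -/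
inductive Interleave :
    List (Request l) → List (Request r) → List (Request (.node w l r)) → Prop
  | nil : Interleave [] [] []
  | left {Rl Rr R} (ρ : Request l) : Interleave Rl Rr R → Interleave (ρ :: Rl) Rr (ρ.inl :: R)
  | right {Rl Rr R} (ρ : Request r) : Interleave Rl Rr R → Interleave Rl (ρ :: Rr) (ρ.inr :: R)

theorem Interleave.perm {Rl : List (Request l)} {Rr : List (Request r)}
    {R : List (Request (.node w l r))} (h : Interleave Rl Rr R) :
    R.Perm (Rl.map Request.inl ++ Rr.map Request.inr) := by
  induction h with
  | nil => rfl
  | left ρ _ ih => exact ih.cons _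
  | right ρ _ ih => exact (ih.cons _).trans List.perm_middle.symm

theorem Interleave.forall_mem {Rl : List (Request l)} {Rr : List (Request r)}
    {R : List (Request (.node w l r))} (h : Interleave Rl Rr R) {p : ℝ → Prop}
    (hl : ∀ ρ ∈ Rl, p ρ.arrival) (hr : ∀ ρ ∈ Rr, p ρ.arrival) : ∀ ρ ∈ R, p ρ.arrival := by
  intro ρ hρ
  rcases List.mem_append.1 (h.perm.mem_iff.1 hρ) with h | h
  · obtain ⟨ρ, h', rfl⟩ := List.mem_map.1 h; exact hl ρ h'
  · obtain ⟨ρ, h', rfl⟩ := List.mem_map.1 h; exact hr ρ h'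

/-- Merge by arrival time; disjointness of the two sets of arrival times makes the result strictly
sorted. -/
theorem exists_interleave (Rl : List (Request l)) (Rr : List (Request r))
    (hl : Rl.Pairwise fun ρ ρ' => ρ.arrival < ρ'.arrival)
    (hr : Rr.Pairwise fun ρ ρ' => ρ.arrival < ρ'.arrival)
    (hd : ∀ ρ ∈ Rl, ∀ ρ' ∈ Rr, ρ.arrival ≠ ρ'.arrival) :
    ∃ R : List (Request (.node w l r)), Interleave Rl Rr R ∧
      R.Pairwise fun ρ ρ' => ρ.arrival < ρ'.arrival := by
  induction Rl generalizing Rr with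
  | nil =>
    have : ∀ Rr : List (Request r),
        Interleave (w := w) (l := l) [] Rr (Rr.map Request.inr) := fun Rr => by
      induction Rr with
      | nil => exact .nil
      | cons ρ Rr ih => exact .right ρ ih
    exact ⟨_, this Rr, List.pairwise_map.2 hr⟩
  | cons ρ Rl ihl =>
    rw [List.pairwise_cons] at hl
    induction Rr with
    | nil =>
      obtain ⟨R, h1, h2⟩ := ihl [] hl.2 .nil (by simp)
      refine ⟨_, h1.left ρ, List.pairwise_cons.2 ⟨?_, h2⟩⟩
      exact h1.forall_mem (p := fun t => ρ.arrival < t) hl.1 (by simp)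
    | cons ρ' Rr ihr =>
      rw [List.pairwise_cons] at hr
      rcases lt_or_gt_of_ne (hd ρ (by simp) ρ' (by simp)) with hlt | hlt
      · obtain ⟨R, h1, h2⟩ := ihl _ hl.2 (List.pairwise_cons.2 hr)
          fun a ha => hd a (List.mem_cons_of_mem _ ha)
        refine ⟨_, h1.left ρ, List.pairwise_cons.2 ⟨?_, h2⟩⟩
        refine h1.forall_mem (p := fun t => ρ.arrival < t) hl.1 ?_
        rintro a (_ | ⟨_, ha⟩)
        exacts [hlt, hlt.trans (hr.1 a ha)]
      · obtain ⟨R, h1, h2⟩ := ihr hr.2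
          fun a ha b hb => hd a ha b (List.mem_cons_of_mem _ hb)
        refine ⟨_, h1.right ρ', List.pairwise_cons.2 ⟨?_, h2⟩⟩
        refine h1.forall_mem (p := fun t => ρ'.arrival < t) ?_ hr.1
        rintro a (_ | ⟨_, ha⟩)
        exacts [hlt, hlt.trans (hl.1 a ha)]

theorem Interleave.countP {Rl : List (Request l)} {Rr : List (Request r)}
    {R : List (Request (.node w l r))} (h : Interleave Rl Rr R) (s : ℝ) :
    (R.countP fun ρ => ρ.arrival ≤ s) =
      (Rl.countP fun ρ => ρ.arrival ≤ s) + Rr.countP fun ρ => ρ.arrival ≤ s := by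
  rw [h.perm.countP_eq, List.countP_append, List.countP_map, List.countP_map]
  rfl

open MeasureTheory Set

variable {σ : State (.node w l r)} {σl : State l} {σr : State r} {K : ℝ}

/-- The timer of the root grows by at most the time during which the left child is odd. -/
theorem Decomposes.root_timer_advance (h : Decomposes σ σl σr K) {k : ℕ} {Rl : List (Request l)}
    (hk : (foot σl.active).isSome ↔ Odd k) (h0 : 0 ≤ σ.timer .root)
    (hw : ENNReal.ofReal (σ.timer .root) + volume (oddTimes k Rl ∩ Ioi σ.clock) <
      ENNReal.ofReal w) {s : ℝ} (hs : σ.clock ≤ s) (hR : ∀ ρ ∈ Rl, s ≤ ρ.arrival) :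
    (∀ e ∈ σ.pending .root, s < e.time) ∧ 0 ≤ (σ.advance s).timer .root ∧
      ENNReal.ofReal ((σ.advance s).timer .root) + volume (oddTimes k Rl ∩ Ioi s) <
        ENNReal.ofReal w := by
  rcases he : σ.pending .root with _ | e
  -- The root is not effective: its timer stands still, and the remaining odd time can only
  -- decrease.
  · have : (σ.advance s).timer .root = σ.timer .root := by simp [State.advance, he]
    rw [this]
    refine ⟨by simp, h0, lt_of_le_of_lt ?_ hw⟩
    gcongr
  · have hodd : Odd k := hk.1 (h.isSome_foot_left he)
    -- The left child is odd and stays so up to time `s`. The increase of the timer is thus paid for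
    -- by odd time that is used up, which keeps the sum of both below `w`.
    have hvol : ENNReal.ofReal (s - σ.clock) + volume (oddTimes k Rl ∩ Ioi s) ≤
        volume (oddTimes k Rl ∩ Ioi σ.clock) := by
      rw [← Real.volume_Ioo, ← measure_union' _ measurableSet_Ioo]
      · refine measure_mono (union_subset (fun t ht => ⟨?_, ht.1⟩) ?_)
        · exact (mem_oddTimes_of_forall_lt fun ρ hρ => ht.2.trans_le (hR ρ hρ)).2 hodd
        · gcongr
      · exact Set.disjoint_left.2 fun t ht ht' => lt_asymm ht.2 ht'.2
    have hlt : ENNReal.ofReal (σ.timer .root + (s - σ.clock)) + volume (oddTimes k Rl ∩ Ioi s) <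
        ENNReal.ofReal w := by
      rw [ENNReal.ofReal_add h0 (sub_nonneg.2 hs), add_assoc]
      exact lt_of_le_of_lt (by gcongr) hw
    have hlt' : σ.timer .root + (s - σ.clock) < w :=
      (ENNReal.ofReal_lt_ofReal_iff'.1 (lt_of_le_of_lt le_self_add hlt)).1
    have htime : s < e.time := by
      rw [(State.pending_eq_some he).2.2.2, State.expiry, weight]
      linarith
    have : (σ.advance s).timer .root = σ.timer .root + (s - σ.clock) := by
      simp [State.advance, he, htime]
    rw [this]
    refine ⟨fun e' he' => by cases he'; exact htime, by linarith, hlt⟩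

theorem State.timer_arrive {T : BinaryTree ℝ} (σ : State T) (ρ : Request T) :
    (σ.arrive ρ).timer = (σ.advance ρ.arrival).timer := by
  rw [State.arrive]
  split <;> rfl

/-- The two subtrees process interleaved requests independently if the left child of the root is odd
for a short time only. -/
theorem Interleave.decomposes {Rl : List (Request l)} {Rr : List (Request r)}
    {R : List (Request (.node w l r))} (hR : Interleave Rl Rr R) :
    ∀ {σ : State (.node w l r)} {σl : State l} {σr : State r} {k : ℕ} {e : ℝ},
      Decomposes σ σl σr K → R.Pairwise (fun ρ ρ' => ρ.arrival < ρ'.arrival) →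
      (∀ ρ ∈ R, σ.clock < ρ.arrival ∧ ρ.arrival ≤ e) → σ.clock ≤ e →
      ((foot σl.active).isSome ↔ Odd k) → 0 ≤ σ.timer .root →
      ENNReal.ofReal (σ.timer .root) + volume (oddTimes k Rl ∩ Ioi σ.clock) < ENNReal.ofReal w →
      Decomposes ((R.foldl State.arrive σ).advance e) ((Rl.foldl State.arrive σl).advance e)
          ((Rr.foldl State.arrive σr).advance e) K ∧
        0 ≤ ((R.foldl State.arrive σ).advance e).timer .root ∧
        ((R.foldl State.arrive σ).advance e).timer .root < w := by
  induction hR with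
  | nil =>
    intro σ σl σr k e h _ _ he hk h0 hw
    obtain ⟨h1, h2, h3⟩ := h.root_timer_advance hk h0 hw he (by simp)
    exact ⟨h.advance h1, h2,
      (ENNReal.ofReal_lt_ofReal_iff'.1 (lt_of_le_of_lt le_self_add h3)).1⟩
  | @left Rl Rr R ρ hR ih =>
    intro σ σl σr k e h hs ht he hk h0 hw
    rw [List.pairwise_cons] at hs
    obtain ⟨hρ, hρe⟩ := ht ρ.inl (by simp)
    have hmem := fun a => hR.perm.mem_iff (a := a)
    have hlt : ∀ ρ' ∈ Rl, ρ.arrival < ρ'.arrival := fun ρ' h' =>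
      hs.1 ρ'.inl ((hmem _).2 (List.mem_append_left _ (List.mem_map_of_mem h')))
    have hrt : ∀ ρ' ∈ Rr, ρ.arrival < ρ'.arrival := fun ρ' h' =>
      hs.1 ρ'.inr ((hmem _).2 (List.mem_append_right _ (List.mem_map_of_mem h')))
    obtain ⟨h1, h2, h3⟩ := h.root_timer_advance hk h0 hw hρ.le (s := ρ.arrival)
      (by rintro a (_ | ⟨_, ha⟩); exacts [le_rfl, (hlt a ha).le])
    have hc : (σ.arrive ρ.inl).clock = ρ.arrival := σ.clock_arrive _
    have htm : (σ.arrive ρ.inl).timer = (σ.advance ρ.arrival).timer := σ.timer_arrive _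
    -- An arrival on the left flips the parity of the left child, so `k` becomes `k + 1`; an arrival
    -- on the right leaves `k` unchanged.
    have := ih (h.arrive_left h1) (k := k + 1) (e := e) hs.2
      (fun a ha => ⟨hc ▸ hs.1 a ha, (ht a (List.mem_cons_of_mem _ ha)).2⟩) (hc ▸ hρe)
      (by rw [State.foot_arrive, hk, Nat.odd_add_one]) (by rw [htm]; exact h2) (by
        rw [htm, hc]
        refine lt_of_le_of_lt ?_ h3
        gcongr 2
        rintro t ⟨ht1, ht2⟩
        exact ⟨(mem_oddTimes_cons (le_of_lt ht2)).2 ht1, ht2⟩)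
    rwa [State.advance_foldl_advance _ _ (fun a ha => (hrt a ha).le) hρe] at this
  | @right Rl Rr R ρ hR ih =>
    intro σ σl σr k e h hs ht he hk h0 hw
    rw [List.pairwise_cons] at hs
    obtain ⟨hρ, hρe⟩ := ht ρ.inr (by simp)
    have hmem := fun a => hR.perm.mem_iff (a := a)
    have hlt : ∀ ρ' ∈ Rl, ρ.arrival ≤ ρ'.arrival := fun ρ' h' =>
      (hs.1 ρ'.inl ((hmem _).2 (List.mem_append_left _ (List.mem_map_of_mem h')))).le
    obtain ⟨h1, h2, h3⟩ := h.root_timer_advance hk h0 hw hρ.le hlt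
    have hc : (σ.arrive ρ.inr).clock = ρ.arrival := σ.clock_arrive _
    have htm : (σ.arrive ρ.inr).timer = (σ.advance ρ.arrival).timer := σ.timer_arrive _
    have := ih (h.arrive_right h1) (k := k) (e := e) hs.2
      (fun a ha => ⟨hc ▸ hs.1 a ha, (ht a (List.mem_cons_of_mem _ ha)).2⟩) (hc ▸ hρe)
      (by rw [State.foot_advance, hk]) (by rw [htm]; exact h2) (by rw [htm, hc]; exact h3)
    rwa [State.advance_foldl_advance _ _ hlt hρe] at this

end StiltWalker

end

noncomputable section

namespace StiltWalker

/-! ### Configurations with at most two active requests -/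

theorem foot_none {T : BinaryTree ℝ} : foot (fun _ : Leaf T => none) = none := by
  induction T with
  | nil => rfl
  | node w l r ihl ihr => simp [foot, ihl, ihr]

theorem support_none {T : BinaryTree ℝ} (v : Inner T) :
    support (fun _ : Leaf T => none) v = none := by
  rcases h : support (fun _ : Leaf T => none) v with _ | p
  · rfl
  · simpa using (support_active h).1

/-- The configuration with one active request, at `x`, that has arrived at time `t`. -/
def single {T : BinaryTree ℝ} (x : Leaf T) (t : ℝ) : Leaf T → Option ℝ :=
  Function.update (fun _ => none) x (some t)

section node

variable {w : ℝ} {l r : BinaryTree ℝ}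

theorem single_left_left (x : Leaf l) (t : ℝ) :
    (fun z => single (.left x : Leaf (.node w l r)) t (.left z)) = single x t := by
  funext z; simp [single, Function.update_apply]

theorem single_left_right (x : Leaf l) (t : ℝ) :
    (fun z => single (.left x : Leaf (.node w l r)) t (.right z)) = fun _ => none := by
  funext z; simp [single]

theorem single_right_left (x : Leaf r) (t : ℝ) :
    (fun z => single (.right x : Leaf (.node w l r)) t (.left z)) = fun _ => none := by
  funext z; simp [single]

theorem single_right_right (x : Leaf r) (t : ℝ) :
    (fun z => single (.right x : Leaf (.node w l r)) t (.right z)) = single x t := by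
  funext z; simp [single, Function.update_apply]

end node

theorem foot_single {T : BinaryTree ℝ} (x : Leaf T) (t : ℝ) : foot (single x t) = some x := by
  induction x with
  | here => simp [foot, single]
  | left x ih => simp only [foot, single_left_left, single_left_right, foot_none, ih]
  | right x ih => simp only [foot, single_right_left, single_right_right, foot_none, ih]

theorem support_single {T : BinaryTree ℝ} (x : Leaf T) (t : ℝ) (v : Inner T) :
    support (single x t) v = none := by
  induction x with
  | here => exact nomatch v
  | left x ih =>
    cases v <;>
      simp only [support, single_left_left, single_left_right, foot_none, foot_single, ih,
        support_none, Option.map_none]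
  | right x ih =>
    cases v <;>
      simp only [support, single_right_left, single_right_right, foot_none, foot_single, ih,
        support_none, Option.map_none]

section quiet

variable {T : BinaryTree ℝ}

theorem State.advance_of_support_eq_none {σ : State T} (h : ∀ v, support σ.active v = none)
    (s : ℝ) : σ.advance s = ⟨s, σ.active, σ.timer, σ.matched⟩ := by
  have hp : ∀ v, σ.pending v = none := fun v => (σ.pending_eq_none_iff v).2 (h v)
  refine State.eq_of rfl (fun x => ?_) (fun v => ?_) ?_ <;> simp [State.advance, hp]

theorem State.arrive_of_eq_none {a : Leaf T → Option ℝ} (ha : ∀ v, support a v = none)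
    {x : Leaf T} (hx : a x = none) (s₀ s : ℝ) (tm : Inner T → ℝ) (M : Multiset (MatchOp T)) :
    (⟨s₀, a, tm, M⟩ : State T).arrive ⟨x, s⟩ = ⟨s, Function.update a x (some s), tm, M⟩ := by
  rw [State.arrive, State.advance_of_support_eq_none ha]
  simp only [hx]

theorem State.arrive_none (x : Leaf T) (s₀ s : ℝ) (tm : Inner T → ℝ) (M : Multiset (MatchOp T)) :
    (⟨s₀, fun _ => none, tm, M⟩ : State T).arrive ⟨x, s⟩ = ⟨s, single x s, tm, M⟩ :=
  State.arrive_of_eq_none support_none rfl _ _ _ _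

theorem State.arrive_single_self (x : Leaf T) (t s₀ s : ℝ) (tm : Inner T → ℝ)
    (M : Multiset (MatchOp T)) :
    (⟨s₀, single x t, tm, M⟩ : State T).arrive ⟨x, s⟩ =
      ⟨s, fun _ => none, tm, M + {⟨⟨x, t⟩, ⟨x, s⟩, s⟩}⟩ := by
  have hx : single x t x = some t := by simp [single]
  rw [State.arrive, State.advance_of_support_eq_none (support_single x t)]
  simp only [hx]
  simp [single]

theorem leafDist_self {T : BinaryTree ℝ} (x : Leaf T) : leafDist x x = 0 := by
  induction x with
  | here => rfl
  | left x ih => simpa [leafDist] using ih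
  | right x ih => simpa [leafDist] using ih

end quiet

section pair

variable {w : ℝ} {l r : BinaryTree ℝ}

/-- The configuration with two active requests, one in each of the two subtrees. -/
def pair (x : Leaf l) (y : Leaf r) (t₁ t₂ : ℝ) : Leaf (.node w l r) → Option ℝ :=
  Function.update (single (.left x) t₁) (.right y) (some t₂)

theorem pair_left (x : Leaf l) (y : Leaf r) (t₁ t₂ : ℝ) :
    (fun z => (pair x y t₁ t₂ : Leaf (.node w l r) → Option ℝ) (.left z)) = single x t₁ := by
  funext z; simp [pair, single, Function.update_apply]

theorem pair_right (x : Leaf l) (y : Leaf r) (t₁ t₂ : ℝ) :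
    (fun z => (pair x y t₁ t₂ : Leaf (.node w l r) → Option ℝ) (.right z)) = single y t₂ := by
  funext z; simp [pair, single, Function.update_apply]

theorem State.pending_pair_root (x : Leaf l) (y : Leaf r) (t₁ t₂ s₀ : ℝ)
    (tm : Inner (.node w l r) → ℝ) (M : Multiset (MatchOp (.node w l r))) :
    (⟨s₀, pair x y t₁ t₂, tm, M⟩ : State (.node w l r)).pending .root =
      some ⟨⟨.left x, t₁⟩, ⟨.right y, t₂⟩, s₀ + (w - tm .root)⟩ :=
  State.pending_eq_some_of (p := (.left x, .right y))
    (by simp only [support, pair_left, pair_right, foot_single])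
    (by simp [pair, single]) (by simp [pair])

theorem State.pending_pair_left (x : Leaf l) (y : Leaf r) (t₁ t₂ s₀ : ℝ)
    (tm : Inner (.node w l r) → ℝ) (M : Multiset (MatchOp (.node w l r))) (v : Inner l) :
    (⟨s₀, pair x y t₁ t₂, tm, M⟩ : State (.node w l r)).pending (.left v) = none := by
  rw [State.pending_eq_none_iff]
  simp only [support, pair_left, support_single, Option.map_none]

theorem State.pending_pair_right (x : Leaf l) (y : Leaf r) (t₁ t₂ s₀ : ℝ)
    (tm : Inner (.node w l r) → ℝ) (M : Multiset (MatchOp (.node w l r))) (v : Inner r) :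
    (⟨s₀, pair x y t₁ t₂, tm, M⟩ : State (.node w l r)).pending (.right v) = none := by
  rw [State.pending_eq_none_iff]
  simp only [support, pair_right, support_single, Option.map_none]

theorem State.arrive_single_right (x : Leaf l) (y : Leaf r) (t s₀ s : ℝ)
    (tm : Inner (.node w l r) → ℝ) (M : Multiset (MatchOp (.node w l r))) :
    (⟨s₀, single (.left x) t, tm, M⟩ : State (.node w l r)).arrive ⟨.right y, s⟩ =
      ⟨s, pair x y t s, tm, M⟩ :=
  State.arrive_of_eq_none (support_single _ _) (by simp [single]) _ _ _ _

open Classical in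
theorem State.advance_pair_of_lt (x : Leaf l) (y : Leaf r) {t₁ t₂ s₀ s : ℝ}
    {tm : Inner (.node w l r) → ℝ} {M : Multiset (MatchOp (.node w l r))}
    (hs : s < s₀ + (w - tm .root)) :
    (⟨s₀, pair x y t₁ t₂, tm, M⟩ : State (.node w l r)).advance s =
      ⟨s, pair x y t₁ t₂, Function.update tm .root (tm .root + (s - s₀)), M⟩ := by
  have h0 := State.pending_pair_root x y t₁ t₂ s₀ tm M
  have h1 := State.pending_pair_left x y t₁ t₂ s₀ tm M
  have h2 := State.pending_pair_right x y t₁ t₂ s₀ tm M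
  refine State.eq_of rfl (fun z => ?_) (fun v => ?_) ?_
  · simp only [State.advance]
    rw [if_neg]
    rw [Inner.exists_node]
    simp [h0, h1, h2, hs]
  · simp only [State.advance]
    rcases v with _ | v | v
    · simp [h0, not_le.2 hs]
    · simp [h1]
    · simp [h2]
  · rw [State.matched_advance, Inner.sum_node]
    simp [State.firing, h0, h1, h2, not_le.2 hs]

open Classical in
theorem State.advance_pair_of_le (x : Leaf l) (y : Leaf r) {t₁ t₂ s₀ s : ℝ}
    {tm : Inner (.node w l r) → ℝ} {M : Multiset (MatchOp (.node w l r))}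
    (hs : s₀ + (w - tm .root) ≤ s) :
    (⟨s₀, pair x y t₁ t₂, tm, M⟩ : State (.node w l r)).advance s =
      ⟨s, fun _ => none, Function.update tm .root 0,
        M + {⟨⟨.left x, t₁⟩, ⟨.right y, t₂⟩, s₀ + (w - tm .root)⟩}⟩ := by
  have h0 := State.pending_pair_root x y t₁ t₂ s₀ tm M
  have h1 := State.pending_pair_left x y t₁ t₂ s₀ tm M
  have h2 := State.pending_pair_right x y t₁ t₂ s₀ tm M
  refine State.eq_of rfl (fun z => ?_) (fun v => ?_) ?_
  · simp only [State.advance]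
    simp only [Inner.exists_node, h0, h1, h2]
    by_cases hx : z = .left x
    · simp [hx, hs]
    · by_cases hy : z = .right y
      · simp [hy, hs]
      · simp [hx, hy, pair, single]
  · simp only [State.advance]
    rcases v with _ | v | v
    · simp [h0, hs]
    · simp [h1]
    · simp [h2]
  · rw [State.matched_advance, Inner.sum_node]
    simp [State.firing, h0, h1, h2, hs]

open Classical in
theorem State.arrive_pair_left (x : Leaf l) (y : Leaf r) {t₁ t₂ s₀ s : ℝ}
    {tm : Inner (.node w l r) → ℝ} {M : Multiset (MatchOp (.node w l r))}
    (hs : s < s₀ + (w - tm .root)) :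
    (⟨s₀, pair x y t₁ t₂, tm, M⟩ : State (.node w l r)).arrive ⟨.left x, s⟩ =
      ⟨s, single (.right y) t₂, Function.update tm .root (tm .root + (s - s₀)),
        M + {⟨⟨.left x, t₁⟩, ⟨.left x, s⟩, s⟩}⟩ := by
  have hx : (pair x y t₁ t₂ : Leaf (.node w l r) → Option ℝ) (.left x) = some t₁ := by
    simp [pair, single]
  rw [State.arrive, State.advance_pair_of_lt x y hs]
  simp only [hx]
  congr 1
  funext z
  by_cases hz : z = .left x
  · simp [hz, single]
  · simp [hz, pair, single, Function.update_apply]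

open Classical in
/-- When the timer of the root is about to expire, its two supporting requests can be replaced by
requests at other leaves, so that the root matches the latter. -/
theorem State.exists_swap (x x' : Leaf l) (y y' : Leaf r) {s₀ t t' u₁ u₂ u₃ u₄ e : ℝ}
    {tm : Inner (.node w l r) → ℝ} {M : Multiset (MatchOp (.node w l r))} (h₁ : t ≤ u₁)
    (h₂ : t' ≤ u₂) (h₃ : u₃ ≤ u₄) (h₄ : u₁ < t' + (w - tm .root))
    (he : e = t' + (w - tm .root) + (u₄ - u₁)) :
    ∃ M', ([⟨.left x, t⟩, ⟨.right y, t'⟩, ⟨.left x, u₁⟩, ⟨.right y, u₂⟩, ⟨.left x', u₃⟩,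
        ⟨.right y', u₄⟩].foldl State.arrive
          (⟨s₀, fun _ => none, tm, M⟩ : State (.node w l r))).advance e =
      ⟨e, fun _ => none, Function.update tm .root 0, M'⟩ ∧
        cost M + w ≤ cost M' := by
  simp only [List.foldl_cons, List.foldl_nil]
  -- The root is effective on `[t', u₁)` and again from `u₄` on, so its timer expires exactly at
  -- `e`.
  rw [State.arrive_none, State.arrive_single_right, State.arrive_pair_left _ _ h₄,
    State.arrive_single_self, State.arrive_none, State.arrive_single_right,
    State.advance_pair_of_le _ _ (by simp only [Function.update_self]; linarith)]
  refine ⟨_, by simp only [Function.update_idem]; rfl, ?_⟩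
  simp only [cost_add, cost_singleton, MatchOp.cost, leafDist_self, leafDist,
    Function.update_self]
  linarith

end pair

end StiltWalker

end

noncomputable section

namespace StiltWalker

open MeasureTheory Set

/-! ### Sweeps: the algorithm matches across every vertex while the optimum pays for the root only -/

theorem isMatching_map_inl {w : ℝ} {l r : BinaryTree ℝ} {R : List (Request l)}
    {M : Multiset (MatchOp l)} (h : IsMatching R M) :
    IsMatching (R.map Request.inl : List (Request (.node w l r))) (M.map MatchOp.inl) := by
  refine ⟨?_, ?_⟩
  · rw [← Multiset.map_coe, ← h.1, Multiset.map_bind, Multiset.bind_map]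
    rfl
  · simp only [Multiset.mem_map]
    rintro _ ⟨e, he, rfl⟩
    exact h.2 e he

theorem isMatching_map_inr {w : ℝ} {l r : BinaryTree ℝ} {R : List (Request r)}
    {M : Multiset (MatchOp r)} (h : IsMatching R M) :
    IsMatching (R.map Request.inr : List (Request (.node w l r))) (M.map MatchOp.inr) := by
  refine ⟨?_, ?_⟩
  · rw [← Multiset.map_coe, ← h.1, Multiset.map_bind, Multiset.bind_map]
    rfl
  · simp only [Multiset.mem_map]
    rintro _ ⟨e, he, rfl⟩
    exact h.2 e he

theorem IsMatching.append {T : BinaryTree ℝ} {R R' : List (Request T)}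
    {M M' : Multiset (MatchOp T)} (h : IsMatching R M) (h' : IsMatching R' M') :
    IsMatching (R ++ R') (M + M') := by
  refine ⟨by rw [Multiset.add_bind, h.1, h'.1, Multiset.coe_add], fun e he => ?_⟩
  rcases Multiset.mem_add.1 he with he | he
  exacts [h.2 e he, h'.2 e he]

theorem IsMatching.perm {T : BinaryTree ℝ} {R R' : List (Request T)} {M : Multiset (MatchOp T)}
    (h : IsMatching R M) (hR : R.Perm R') : IsMatching R' M :=
  ⟨h.1.trans (Multiset.coe_eq_coe.2 hR), h.2⟩

theorem isMatching_pair {T : BinaryTree ℝ} {ρ ρ' : Request T} (h : ρ.arrival ≤ ρ'.arrival) :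
    IsMatching [ρ, ρ'] {⟨ρ, ρ', ρ'.arrival⟩} := by
  refine ⟨by simp; rfl, ?_⟩
  simpa using h

/-- The leftmost leaf. -/
def leafA : (T : BinaryTree ℝ) → Leaf T
  | .nil => .here
  | .node _ l _ => .left (leafA l)

/-- The leftmost leaf of the right subtree, if there is one. -/
def leafB : (T : BinaryTree ℝ) → Leaf T
  | .nil => .here
  | .node _ _ r => .right (leafA r)

/-- From the state `σ`, the requests at `leafA T`, at `leafB T` and in `R` lead the algorithm to
matching across every vertex of `T` up to time `e`, while the requests in `R` can be matched at cost
at most `ε`. -/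
structure IsSweep {T : BinaryTree ℝ} (σ : State T) (F : Finset ℝ) (ε t t' : ℝ)
    (R : List (Request T)) (M : Multiset (MatchOp T)) (e : ℝ) : Prop where
  sorted : (⟨leafA T, t⟩ :: ⟨leafB T, t'⟩ :: R).Pairwise fun ρ ρ' => ρ.arrival < ρ'.arrival
  lt_arrival : ∀ ρ ∈ ⟨leafA T, t⟩ :: ⟨leafB T, t'⟩ :: R, σ.clock < ρ.arrival
  arrival_le : ∀ ρ ∈ ⟨leafA T, t⟩ :: ⟨leafB T, t'⟩ :: R, ρ.arrival ≤ e
  -- The freedom to avoid `F` makes the arrival times of sibling sweeps distinct.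
  arrival_notMem : ∀ ρ ∈ ⟨leafA T, t⟩ :: ⟨leafB T, t'⟩ :: R, ρ.arrival ∉ F
  -- The opening requests come early enough to be matched cheaply with requests that the parent has
  -- placed at the same leaves shortly before.
  le_add : t' ≤ σ.clock + ε
  isMatching : IsMatching R M
  cost_le : cost M ≤ ε
  -- This keeps the timer of the parent from expiring during the sweep.
  volume_le : volume (oddTimes 0 (⟨leafA T, t⟩ :: ⟨leafB T, t'⟩ :: R)) ≤ ENNReal.ofReal ε
  active_eq : (((⟨leafA T, t⟩ :: ⟨leafB T, t'⟩ :: R).foldl State.arrive σ).advance e).active =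
    fun _ => none
  -- Together with `active_eq`, this restores the hypotheses under which the next sweep can start.
  timer_mem : ∀ v, (((⟨leafA T, t⟩ :: ⟨leafB T, t'⟩ :: R).foldl State.arrive σ).advance e).timer v ∈
    Ico 0 (weight v)
  le_cost : cost σ.matched + ∑ v : Inner T, weight v ≤
    cost (((⟨leafA T, t⟩ :: ⟨leafB T, t'⟩ :: R).foldl State.arrive σ).advance e).matched

/-- Used to prolong the shorter of two sibling sweeps to the common end time. -/
theorem State.advance_of_active_eq {T : BinaryTree ℝ} {σ : State T} {e s : ℝ} (h : e ≤ s)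
    (ha : (σ.advance e).active = fun _ => none) :
    σ.advance s = ⟨s, fun _ => none, (σ.advance e).timer, (σ.advance e).matched⟩ := by
  rw [← σ.advance_advance h, State.advance_of_support_eq_none (by simp [ha, support_none]), ha]

theorem exists_mem_Ioo_notMem (F : Finset ℝ) {a b : ℝ} (h : a < b) : ∃ x, a < x ∧ x < b ∧ x ∉ F := by
  obtain ⟨x, hx, hF⟩ := (Ioo_infinite h).exists_notMem_finset F
  exact ⟨x, hx.1, hx.2, hF⟩

/-- Both opening requests are at the only leaf and are matched at once, so nothing else is needed.
-/
theorem exists_sweep_nil (σ : State .nil) (ha : σ.active = fun _ => none) (F : Finset ℝ) {ε : ℝ}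
    (hε : 0 < ε) : ∃ t t' R M e, IsSweep σ F ε t t' R M e := by
  obtain ⟨t, h1, h2, h3⟩ := exists_mem_Ioo_notMem F (lt_add_of_pos_right σ.clock hε)
  obtain ⟨t', h1', h2', h3'⟩ := exists_mem_Ioo_notMem F h2
  obtain ⟨s₀, a, tm, N⟩ := σ
  obtain rfl : a = fun _ => none := ha
  have hrun : (([⟨leafA .nil, t⟩, ⟨leafB .nil, t'⟩] : List (Request .nil)).foldl State.arrive
      ⟨s₀, fun _ => none, tm, N⟩).advance t' =
      ⟨t', fun _ => none, tm, N + {⟨⟨.here, t⟩, ⟨.here, t'⟩, t'⟩}⟩ := by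
    simp only [List.foldl_cons, List.foldl_nil, State.arrive_none, leafA, leafB]
    rw [State.arrive_single_self, State.advance_of_support_eq_none support_none]
  refine ⟨t, t', [], 0, t', ?_⟩
  constructor
  · simpa using h1'
  · simp only [List.mem_cons, List.not_mem_nil, or_false]
    rintro _ (rfl | rfl)
    exacts [h1, h1.trans h1']
  · simp [h1'.le]
  · simp [h3, h3']
  · exact h2'.le
  · exact ⟨rfl, by simp⟩
  · simpa [cost_zero] using hε.le
  · calc volume (oddTimes 0 ([⟨leafA .nil, t⟩, ⟨leafB .nil, t'⟩] : List (Request .nil)))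
        ≤ volume (Ico t t') := by
          refine measure_mono fun s hs => ?_
          rw [mem_oddTimes] at hs
          by_cases hs1 : t ≤ s <;> by_cases hs2 : t' ≤ s
          · simp only [hs1, hs2, List.countP_cons, List.countP_nil, decide_true, if_true] at hs
            exact absurd hs (by decide)
          · exact ⟨hs1, not_le.1 hs2⟩
          · exact absurd (h1'.le.trans hs2) hs1
          · simp [hs1, hs2] at hs
      _ ≤ ENNReal.ofReal ε := by
          rw [Real.volume_Ico]
          exact ENNReal.ofReal_le_ofReal (by simp only at h1 h2'; linarith)
  · rw [hrun]
  · exact fun v => nomatch v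
  · rw [hrun]
    rw [Finset.sum_eq_zero fun v _ => nomatch v]
    simp only [cost_add, cost_singleton, MatchOp.cost, leafDist_self]
    linarith

end StiltWalker

end

/-! ### Odd times and offline matching of a composed sweep -/

noncomputable section

namespace StiltWalker

open MeasureTheory Set

variable {w : ℝ} {l r : BinaryTree ℝ}

/-- Outside the two intervals 0, 2 or 6 of the six extra requests have arrived, so an odd total
requires an odd count in one of the subtrees. -/
theorem volume_oddTimes_le {Rl : List (Request l)} {Rr : List (Request r)}
    {R : List (Request (.node w l r))} (h : Interleave Rl Rr R)
    {ρ₁ ρ₂ ρ₃ ρ₄ ρ₅ ρ₆ : Request (.node w l r)}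
    (hs : [ρ₁, ρ₂, ρ₃, ρ₄, ρ₅, ρ₆].Pairwise fun ρ ρ' => ρ.arrival < ρ'.arrival) :
    volume (oddTimes 0 ([ρ₁, ρ₂, ρ₃, ρ₄, ρ₅, ρ₆] ++ R)) ≤
      ENNReal.ofReal (ρ₂.arrival - ρ₁.arrival) + ENNReal.ofReal (ρ₆.arrival - ρ₃.arrival) +
        volume (oddTimes 0 Rl) + volume (oddTimes 0 Rr) := by
  simp only [List.pairwise_cons, List.mem_cons, List.not_mem_nil, or_false, forall_eq_or_imp,
    forall_eq] at hs
  obtain ⟨⟨h12, h13, -⟩, ⟨h23, -⟩, ⟨h34, -⟩, ⟨h45, -⟩, h56, -⟩ := hs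
  rw [← Real.volume_Ico, ← Real.volume_Ico]
  refine le_trans (measure_mono ?_) ((measure_union_le _ _).trans (add_le_add_left
    ((measure_union_le _ _).trans (add_le_add_left (measure_union_le _ _) _)) _))
  intro s hs
  simp only [mem_oddTimes, List.countP_append, h.countP, zero_add, mem_union, mem_Ico] at hs ⊢
  by_contra! hc
  obtain ⟨⟨⟨h1, h2⟩, h3⟩, h4⟩ := hc
  rw [Nat.not_odd_iff_even] at h3 h4
  rw [Nat.odd_add', ] at hs
  have h6 := (h3.add h4)
  have h7 : Odd (List.countP (fun ρ => decide (ρ.arrival ≤ s)) [ρ₁, ρ₂, ρ₃, ρ₄, ρ₅, ρ₆]) := by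
    rw [Nat.odd_iff] at *; rw [Nat.even_iff] at *; omega
  revert h7
  rw [imp_false, Nat.not_odd_iff_even]
  by_cases c1 : ρ₁.arrival ≤ s
  · have c2 := h1 c1
    by_cases c3 : ρ₃.arrival ≤ s
    · have c6 := h2 c3
      have c5 := h56.le.trans c6
      have c4 := h45.le.trans c5
      simp only [List.countP_cons, c1, c2, c3, c4, c5, c6, decide_true, if_true, List.countP_nil]
      decide
    · rw [not_le] at c3
      have c4 := c3.trans h34
      have c5 := c4.trans h45
      have c6 := c5.trans h56
      simp only [List.countP_cons, c1, c2, not_le.2 c3, not_le.2 c4, not_le.2 c5, not_le.2 c6,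
        decide_true, if_true, List.countP_nil, decide_false, Bool.false_eq_true, if_false]
      decide
  · rw [not_le] at c1
    have c2 := c1.trans h12
    have c3 := c2.trans h23
    have c4 := c3.trans h34
    have c5 := c4.trans h45
    have c6 := c5.trans h56
    simp only [List.countP_cons, not_le.2 c1, not_le.2 c2, not_le.2 c3, not_le.2 c4, not_le.2 c5,
      not_le.2 c6, List.countP_nil, decide_false, Bool.false_eq_true, if_false]
    decide

/-- The opening requests of both subtree sweeps are paired with the four earlier requests at the
same leaves. Each such pair costs only a delay of at most `ε`, and no subtree root is paid for. -/
theorem isMatching_interleave {Rl : List (Request l)} {Rr : List (Request r)}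
    {R : List (Request (.node w l r))} {Ml : Multiset (MatchOp l)} {Mr : Multiset (MatchOp r)}
    {x x' : Leaf l} {y y' : Leaf r} {t₁ t₁' t₂ t₂' u₁ u₂ u₃ u₄ c ε : ℝ}
    (h : Interleave (⟨x, t₁⟩ :: ⟨x', t₁'⟩ :: Rl) (⟨y, t₂⟩ :: ⟨y', t₂'⟩ :: Rr) R)
    (hl : IsMatching Rl Ml) (hr : IsMatching Rr Mr) (h₁ : u₁ ≤ t₁) (h₂ : u₂ ≤ t₂) (h₃ : u₃ ≤ t₁')
    (h₄ : u₄ ≤ t₂') (hcl : cost Ml ≤ c) (hcr : cost Mr ≤ c) (hc₁ : t₁ ≤ u₁ + ε)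
    (hc₂ : t₂ ≤ u₂ + ε) (hc₃ : t₁' ≤ u₃ + ε) (hc₄ : t₂' ≤ u₄ + ε) :
    ∃ M, IsMatching (⟨.left x, u₁⟩ :: ⟨.right y, u₂⟩ :: ⟨.left x', u₃⟩ :: ⟨.right y', u₄⟩ :: R) M ∧
      cost M ≤ 4 * ε + 2 * c := by
  have m1 := isMatching_pair (T := .node w l r) (ρ := ⟨.left x, u₁⟩) (ρ' := ⟨.left x, t₁⟩) h₁
  have m2 := isMatching_pair (T := .node w l r) (ρ := ⟨.right y, u₂⟩) (ρ' := ⟨.right y, t₂⟩) h₂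
  have m3 := isMatching_pair (T := .node w l r) (ρ := ⟨.left x', u₃⟩) (ρ' := ⟨.left x', t₁'⟩) h₃
  have m4 := isMatching_pair (T := .node w l r) (ρ := ⟨.right y', u₄⟩) (ρ' := ⟨.right y', t₂'⟩) h₄
  refine ⟨_, ((m1.append m2).append ((m3.append m4).append
    ((isMatching_map_inl hl).append (isMatching_map_inr hr)))).perm ?_, ?_⟩
  · rw [← Multiset.coe_eq_coe]
    have := Multiset.coe_eq_coe.2 h.perm
    simp only [← Multiset.coe_add, ← Multiset.cons_coe, ← Multiset.singleton_add, List.map_cons,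
      List.cons_append, List.nil_append] at this ⊢
    rw [this]
    simp only [Request.inl, Request.inr]
    abel
  · simp only [cost_add, cost_singleton, MatchOp.cost, leafDist_self, cost_map_inl, cost_map_inr]
    linarith

end StiltWalker

end

/-! ### Recursive construction of a sweep -/

noncomputable section

namespace StiltWalker

open MeasureTheory Set

open Classical in
theorem exists_sweep {T : BinaryTree ℝ} (hw : ∀ v : Inner T, 0 < weight v) (σ : State T)
    (ha : σ.active = fun _ => none) (htm : ∀ v, σ.timer v ∈ Ico 0 (weight v)) (F : Finset ℝ)
    {ε : ℝ} (hε : 0 < ε) : ∃ t t' R M e, IsSweep σ F ε t t' R M e := by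
  induction T generalizing F ε with
  | nil => exact exists_sweep_nil σ ha F hε
  | node w l r ihl ihr =>
    obtain ⟨s₀, a, tm, N⟩ := σ
    obtain rfl : a = fun _ => none := ha
    have hw0 : 0 < w := hw .root
    obtain ⟨htm0, htmw⟩ : 0 ≤ tm .root ∧ tm .root < w := htm .root
    -- The offline cost will be at most `4 * (3 * δ) + 2 * δ` and the odd time at most `4 * δ`, both
    -- below `ε`. The bound `w / 2` keeps the odd time of the left child below `w`.
    obtain ⟨δ, hδ, hδε, hδw⟩ : ∃ δ : ℝ, 0 < δ ∧ δ ≤ ε / 20 ∧ δ ≤ w / 2 :=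
      ⟨min (ε / 20) (w / 2), by positivity, min_le_left _ _, min_le_right _ _⟩
    obtain ⟨t, h0t, htδ, htF⟩ := exists_mem_Ioo_notMem F (lt_add_of_pos_right s₀ hδ)
    obtain ⟨t', htt', ht'δ, ht'F⟩ := exists_mem_Ioo_notMem F htδ
    -- `E` is when the root would fire without further arrivals; the four swap requests are squeezed
    -- into `(E - δ, E)`.
    obtain ⟨E, hE⟩ : ∃ E, E = t' + (w - tm .root) := ⟨_, rfl⟩
    obtain ⟨u₁, h1, h1E, h1F⟩ := exists_mem_Ioo_notMem F
      (show max t' (E - δ) < E from max_lt (by linarith) (by linarith))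
    obtain ⟨h1', h1δ⟩ := max_lt_iff.1 h1
    obtain ⟨u₂, h2, h2E, h2F⟩ := exists_mem_Ioo_notMem F h1E
    obtain ⟨u₃, h3, h3E, h3F⟩ := exists_mem_Ioo_notMem F h2E
    obtain ⟨u₄, h4, h4E, h4F⟩ := exists_mem_Ioo_notMem F h3E
    obtain ⟨e₀, he₀⟩ : ∃ e₀, e₀ = t' + (w - tm .root) + (u₄ - u₁) := ⟨_, rfl⟩
    obtain ⟨N', hrun, hcost⟩ := State.exists_swap (s₀ := s₀) (t := t) (u₂ := u₂) (M := N) (leafA l) (leafB l)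
      (leafA r) (leafB r) (by linarith) (by linarith) h4.le (hE ▸ h1E) he₀
    obtain ⟨tl, tl', Rl, Ml, el, Sl⟩ := ihl (fun v => hw (.left v))
      ⟨e₀, fun _ => none, fun v => tm (.left v), 0⟩ rfl (fun v => htm (.left v)) F hδ
    obtain ⟨tr, tr', Rr, Mr, er, Sr⟩ := ihr (fun v => hw (.right v))
      -- The right sweep also avoids the arrival times of the left one.
      ⟨e₀, fun _ => none, fun v => tm (.right v), 0⟩ rfl (fun v => htm (.right v))
      (F ∪ ((⟨leafA l, tl⟩ :: ⟨leafB l, tl'⟩ :: Rl).map Request.arrival).toFinset) hδ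
    obtain ⟨Rm, hI, hs⟩ := exists_interleave (w := w) _ _ Sl.sorted Sr.sorted
      fun ρ hρ ρ' hρ' heq => Sr.arrival_notMem ρ' hρ' (Finset.mem_union_right _
        (List.mem_toFinset.2 (heq ▸ List.mem_map_of_mem hρ)))
    have hl : e₀ < tl := Sl.lt_arrival ⟨leafA l, tl⟩ (by simp)
    have hr : e₀ < tr := Sr.lt_arrival ⟨leafA r, tr⟩ (by simp)
    have hl' : tl < tl' := (List.pairwise_cons.1 Sl.sorted).1 ⟨leafB l, tl'⟩ (by simp)
    have hr' : tr < tr' := (List.pairwise_cons.1 Sr.sorted).1 ⟨leafB r, tr'⟩ (by simp)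
    have hlδ : tl' ≤ e₀ + δ := Sl.le_add
    have hrδ : tr' ≤ e₀ + δ := Sr.le_add
    -- The delay `3 * δ` consists of less than `δ` from `u₁` to `E`, less than `δ` from `E` to `e₀`,
    -- and at most `δ` from `e₀` to the opening requests.
    obtain ⟨M, hM, hMc⟩ := isMatching_interleave (u₁ := u₁) (u₂ := u₂) (u₃ := u₃) (u₄ := u₄)
      (c := δ) (ε := 3 * δ) hI Sl.isMatching Sr.isMatching
      (by linarith) (by linarith) (by linarith) (by linarith)
      Sl.cost_le Sr.cost_le
      (by linarith) (by linarith) (by linarith) (by linarith)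
    have hgt : ∀ ρ ∈ Rm, e₀ < ρ.arrival :=
      hI.forall_mem (p := fun s => e₀ < s) Sl.lt_arrival Sr.lt_arrival
    have hle : ∀ ρ ∈ Rm, ρ.arrival ≤ max el er :=
      hI.forall_mem (p := fun s => s ≤ max el er) (fun ρ hρ => le_max_of_le_left (Sl.arrival_le ρ hρ))
        (fun ρ hρ => le_max_of_le_right (Sr.arrival_le ρ hρ))
    have hnm : ∀ ρ ∈ Rm, ρ.arrival ∉ F :=
      hI.forall_mem (p := fun s => s ∉ F) Sl.arrival_notMem fun ρ hρ h =>
        Sr.arrival_notMem ρ hρ (Finset.mem_union_left _ h)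
    have he : e₀ ≤ max el er :=
      le_max_of_le_left (hl.le.trans (Sl.arrival_le ⟨leafA l, tl⟩ (by simp)))
    -- The timer of the root has just been reset and the left child is odd for time at most `δ < w`,
    -- so the root does not fire again. The cost `K` so far already includes the matching across the
    -- root.
    obtain ⟨hD, hroot0, hrootw⟩ := hI.decomposes (K := cost N') (k := 0) (e := max el er)
      (σ := ⟨e₀, fun _ => none, Function.update tm .root 0, N'⟩)
      (σl := ⟨e₀, fun _ => none, fun v => tm (.left v), 0⟩)
      (σr := ⟨e₀, fun _ => none, fun v => tm (.right v), 0⟩)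
      ⟨rfl, rfl, fun _ => rfl, fun _ => rfl, fun _ => by simp, fun _ => by simp, by simp [cost_zero]⟩
      hs (fun ρ hρ => ⟨hgt ρ hρ, hle ρ hρ⟩) he (by simp [foot_none]) (by simp) (by
        simp only [Function.update_self, ENNReal.ofReal_zero, zero_add]
        refine ((measure_mono inter_subset_left).trans Sl.volume_le).trans_lt ?_
        exact (ENNReal.ofReal_lt_ofReal_iff hw0).2 (by linarith))
    rw [State.advance_of_active_eq (le_max_left el er) Sl.active_eq,
      State.advance_of_active_eq (le_max_right el er) Sr.active_eq] at hD
    rw [← hrun, State.advance_foldl_advance _ _ (fun ρ hρ => (hgt ρ hρ).le) he,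
      ← List.foldl_append] at hD hroot0 hrootw
    have hsix : ([⟨.left (leafA l), t⟩, ⟨.right (leafA r), t'⟩, ⟨.left (leafA l), u₁⟩,
        ⟨.right (leafA r), u₂⟩, ⟨.left (leafB l), u₃⟩, ⟨.right (leafB r), u₄⟩] :
        List (Request (.node w l r))).Pairwise fun ρ ρ' => ρ.arrival < ρ'.arrival := by
      simp only [List.pairwise_cons, List.mem_cons, List.not_mem_nil, or_false, forall_eq_or_imp,
        forall_eq, List.Pairwise.nil, and_true, false_implies, implies_true]
      refine ⟨⟨?_, ?_, ?_, ?_, ?_⟩, ⟨?_, ?_, ?_, ?_⟩, ⟨?_, ?_, ?_⟩, ⟨?_, ?_⟩, ?_⟩ <;> linarith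
    have hall : ∀ (p : ℝ → Prop) (R : List (Request (.node w l r))), p t → p t' → p u₁ → p u₂ →
        p u₃ → p u₄ → (∀ ρ ∈ R, p ρ.arrival) → ∀ ρ ∈ [⟨.left (leafA l), t⟩,
          ⟨.right (leafA r), t'⟩, ⟨.left (leafA l), u₁⟩, ⟨.right (leafA r), u₂⟩,
          ⟨.left (leafB l), u₃⟩, ⟨.right (leafB r), u₄⟩] ++ R, p (Request.arrival ρ) := by
      intro p R p1 p2 p3 p4 p5 p6 p7
      simpa only [List.cons_append, List.nil_append, List.forall_mem_cons, p1, p2, p3, p4, p5, p6,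
        true_and] using p7
    refine ⟨t, t', ⟨.left (leafA l), u₁⟩ :: ⟨.right (leafA r), u₂⟩ :: ⟨.left (leafB l), u₃⟩ ::
      ⟨.right (leafB r), u₄⟩ :: Rm, M, max el er, ?_⟩
    constructor
    · refine List.pairwise_append.2 ⟨hsix, hs, fun ρ hρ ρ' hρ' => ?_⟩
      refine lt_of_le_of_lt ?_ (hgt ρ' hρ')
      exact hall (fun s => s ≤ e₀) [] (by linarith) (by linarith) (by linarith) (by linarith)
        (by linarith) (by linarith) (by simp) ρ hρ
    · exact hall (fun s => s₀ < s) Rm (by linarith) (by linarith) (by linarith) (by linarith)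
        (by linarith) (by linarith) fun ρ hρ => by linarith [hgt ρ hρ]
    · exact hall (fun s => s ≤ max el er) Rm (by linarith) (by linarith) (by linarith) (by linarith)
        (by linarith) (by linarith) hle
    · exact hall (fun s => s ∉ F) Rm htF ht'F h1F h2F h3F h4F hnm
    · show t' ≤ s₀ + ε
      linarith
    · exact hM
    · linarith
    · refine (volume_oddTimes_le hI hsix).trans ?_
      refine (add_le_add (add_le_add_right Sl.volume_le _) Sr.volume_le).trans ?_
      rw [← ENNReal.ofReal_add, ← ENNReal.ofReal_add, ← ENNReal.ofReal_add]
      · exact ENNReal.ofReal_le_ofReal (by simp only; linarith)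
      all_goals linarith
    · funext x
      cases x with
      | left x => exact (hD.active_left x).symm
      | right x => exact (hD.active_right x).symm
    · intro v
      rcases v with _ | v | v
      · exact ⟨hroot0, hrootw⟩
      · have := Sl.timer_mem v
        rw [show _ = _ from hD.timer_left v] at this
        exact this
      · have := Sr.timer_mem v
        rw [show _ = _ from hD.timer_right v] at this
        exact this
    · have h1 := hD.cost_eq
      have h2 := Sl.le_cost
      have h3 := Sr.le_cost
      rw [Inner.sum_node]
      simp only [cost_zero, zero_add] at h1 h2 h3
      simp only [weight]
      refine le_trans ?_ h1.ge
      linarith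

end StiltWalker

end

noncomputable section

namespace StiltWalker

open Set

variable {T : BinaryTree ℝ}

/-! ### Lower bound on the competitive ratio by the total weight of a tree -/

theorem leafDist_nonneg (hw : ∀ v : Inner T, 0 < weight v) (x y : Leaf T) : 0 ≤ leafDist x y := by
  induction T with
  | nil => cases x; cases y; exact le_rfl
  | node w l r ihl ihr =>
    cases x <;> cases y
    · exact ihl (fun v => hw (.left v)) _ _
    · exact (hw .root).le
    · exact (hw .root).le
    · exact ihr (fun v => hw (.right v)) _ _

theorem leafDist_leafA_leafB : leafDist (leafA T) (leafB T) = rootWeight T := by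
  cases T <;> rfl

theorem cost_nonneg (hw : ∀ v : Inner T, 0 < weight v) {R : List (Request T)}
    {M : Multiset (MatchOp T)} (h : IsMatching R M) : 0 ≤ cost M := by
  refine Multiset.sum_nonneg fun c hc => ?_
  obtain ⟨e, he, rfl⟩ := Multiset.mem_map.1 hc
  obtain ⟨h1, h2⟩ := h.2 e he
  have := leafDist_nonneg hw e.fst.loc e.snd.loc
  rw [MatchOp.cost]
  linarith

theorem opt_nonneg (hw : ∀ v : Inner T, 0 < weight v) (R : List (Request T)) : 0 ≤ opt R :=
  Real.sInf_nonneg (by rintro _ ⟨M, hM, rfl⟩; exact cost_nonneg hw hM)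

theorem opt_le (hw : ∀ v : Inner T, 0 < weight v) {R : List (Request T)}
    {M : Multiset (MatchOp T)} (h : IsMatching R M) : opt R ≤ cost M :=
  csInf_le ⟨0, by rintro _ ⟨M, hM, rfl⟩; exact cost_nonneg hw hM⟩ ⟨M, h, rfl⟩

theorem IsMatching.even_length {R : List (Request T)} {M : Multiset (MatchOp T)}
    (h : IsMatching R M) : Even R.length := by
  have := congrArg Multiset.card h.1
  rw [Multiset.card_bind, Multiset.coe_card] at this
  rw [← this]
  exact ⟨Multiset.card M, by simp [mul_two]⟩

/-- Sweeps are concatenated: each ends with no active request and with timers below the weights, as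
the next one requires. -/
theorem exists_sweeps (hw : ∀ v : Inner T, 0 < weight v) (N : ℕ) :
    ∃ (R : List (Request T)) (M : Multiset (MatchOp T)) (e : ℝ),
      R.Pairwise (fun ρ ρ' => ρ.arrival < ρ'.arrival) ∧ (∀ ρ ∈ R, 0 < ρ.arrival) ∧
      (∀ ρ ∈ R, ρ.arrival ≤ e) ∧ 0 ≤ e ∧ IsMatching R M ∧ cost M ≤ N * (rootWeight T + 1) ∧
      ((R.foldl State.arrive (State.init T)).advance e).active = (fun _ => none) ∧
      (∀ v, ((R.foldl State.arrive (State.init T)).advance e).timer v ∈ Ico 0 (weight v)) ∧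
      N * ∑ v : Inner T, weight v ≤
        cost ((R.foldl State.arrive (State.init T)).advance e).matched := by
  induction N with
  | zero =>
    have h0 : (State.init T).advance 0 = State.init T :=
      State.advance_of_support_eq_none (σ := State.init T) support_none 0
    refine ⟨[], 0, 0, .nil, by simp, by simp, le_rfl, ⟨rfl, by simp⟩, by simp [cost_zero], ?_⟩
    rw [List.foldl_nil, h0]
    exact ⟨rfl, fun v => ⟨le_rfl, hw v⟩, by simp [State.init, cost_zero]⟩
  | succ N ih =>
    obtain ⟨R, M, e, hs, hpos, hle, he, hM, hc, ha, ht, hN⟩ := ih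
    -- One half bounds the delay of the opening pair, the other half the cost of the remaining
    -- requests; together they give the `+ 1`.
    obtain ⟨t, t', R', M', e', S⟩ := exists_sweep hw _ ha ht ∅ (ε := 1 / 2) (by norm_num)
    have hgt : ∀ ρ ∈ (⟨leafA T, t⟩ :: ⟨leafB T, t'⟩ :: R'), e < ρ.arrival := S.lt_arrival
    have htt' : t < t' := (List.pairwise_cons.1 S.sorted).1 ⟨leafB T, t'⟩ (by simp)
    have hte : e < t := hgt ⟨leafA T, t⟩ (by simp)
    have hte' : t ≤ e' := S.arrival_le ⟨leafA T, t⟩ (by simp)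
    have hrun := State.advance_foldl_advance (R.foldl State.arrive (State.init T)) (e := e') _
      (fun ρ hρ => (hgt ρ hρ).le) (by linarith)
    rw [← List.foldl_append] at hrun
    have h1 := S.active_eq
    have h2 := S.timer_mem
    have h3 := S.le_cost
    rw [hrun] at h1 h2 h3
    have hm := isMatching_pair (ρ := ⟨leafA T, t⟩) (ρ' := ⟨leafB T, t'⟩) htt'.le
    refine ⟨_, M + ({⟨⟨leafA T, t⟩, ⟨leafB T, t'⟩, t'⟩} + M'), e', ?_, ?_, ?_, ?_,
      hM.append (hm.append S.isMatching), ?_, h1, h2, ?_⟩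
    · exact List.pairwise_append.2 ⟨hs, S.sorted, fun ρ hρ ρ' hρ' =>
        (hle ρ hρ).trans_lt (hgt ρ' hρ')⟩
    · intro ρ hρ
      rcases List.mem_append.1 hρ with hρ | hρ
      · exact hpos ρ hρ
      · exact he.trans_lt (hgt ρ hρ)
    · intro ρ hρ
      rcases List.mem_append.1 hρ with hρ | hρ
      · exact (hle ρ hρ).trans (by linarith)
      · exact S.arrival_le ρ hρ
    · linarith
    · have h4 : t' ≤ e + 1 / 2 := S.le_add
      have h5 := S.cost_le
      simp only [cost_add, cost_singleton, MatchOp.cost, leafDist_leafA_leafB, Nat.cast_add,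
        Nat.cast_one]
      linarith
    · refine le_trans ?_ h3
      push_cast
      linarith

/-- If the inequality failed, each sweep would add a fixed positive amount to the excess of the
algorithm, which would eventually exceed `β`. The maximum with `0` covers negative `ρ`, for which
upper bounds on `opt` could not be multiplied. -/
theorem sum_weight_le_of_isCompetitiveOn {C : Set (BinaryTree ℝ)} {ρ : ℝ} (h : IsCompetitiveOn C ρ)
    (hT : T ∈ C) (hw : ∀ v : Inner T, 0 < weight v) :
    ∑ v : Inner T, weight v ≤ max ρ 0 * (rootWeight T + 1) := by
  obtain ⟨β, hβ⟩ := h T hT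
  by_contra! hlt
  obtain ⟨N, hN⟩ := exists_nat_gt (β / (∑ v : Inner T, weight v - max ρ 0 * (rootWeight T + 1)))
  rw [div_lt_iff₀ (sub_pos.2 hlt)] at hN
  obtain ⟨R, M, e, hs, hpos, -, -, hM, hc, ha, -, hcost⟩ := exists_sweeps hw N
  have h1 := hβ R ⟨hs, fun ρ hρ => (hpos ρ hρ).le, hM.even_length⟩
  rw [stiltWalk, State.finish_of_advance_active ha] at h1
  have h2 : ρ * opt R ≤ max ρ 0 * (N * (rootWeight T + 1)) :=
    mul_le_mul (le_max_left _ _) ((opt_le hw hM).trans hc) (opt_nonneg hw R) (le_max_right _ _)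
  linarith

/-! ### Balanced trees -/

/-- A balanced tree with `n ≤ 2 ^ k` leaves and root weight `a` whose weights decrease by the factor
`α` along every edge between internal vertices. -/
def balanced (α : ℝ) : ℕ → ℝ → ℕ → BinaryTree ℝ
  | 0, _, _ => .nil
  | k + 1, a, n =>
    if n ≤ 1 then .nil
    else .node a (balanced α k (a / α) (n / 2)) (balanced α k (a / α) (n - n / 2))

theorem balanced_of_le (α : ℝ) (k : ℕ) (a : ℝ) {n : ℕ} (h : n ≤ 1) :
    balanced α (k + 1) a n = .nil := if_pos h

theorem balanced_of_lt (α : ℝ) (k : ℕ) (a : ℝ) {n : ℕ} (h : 1 < n) :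
    balanced α (k + 1) a n =
      .node a (balanced α k (a / α) (n / 2)) (balanced α k (a / α) (n - n / 2)) :=
  if_neg (not_le.2 h)

theorem sum_weight_nil : ∑ v : Inner .nil, weight v = 0 := rfl

theorem card_leaf_nil : Fintype.card (Leaf .nil) = 1 := rfl

theorem card_leaf_node (w : ℝ) (l r : BinaryTree ℝ) :
    Fintype.card (Leaf (.node w l r)) = Fintype.card (Leaf l) + Fintype.card (Leaf r) := by
  rw [← Fintype.card_sum, Fintype.card_congr Leaf.nodeEquiv.symm]

theorem card_leaf_balanced (α : ℝ) {k : ℕ} (a : ℝ) {n : ℕ} (h1 : 1 ≤ n) (hn : n ≤ 2 ^ k) :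
    Fintype.card (Leaf (balanced α k a n)) = n := by
  induction k generalizing a n with
  | zero => rw [balanced, card_leaf_nil]; simp at hn; omega
  | succ k ih =>
    rw [balanced]
    split_ifs with h
    · rw [card_leaf_nil]; omega
    · rw [pow_succ] at hn
      rw [card_leaf_node, ih _ (by omega) (by omega), ih _ (by omega) (by omega)]
      omega

theorem rootWeight_balanced (α : ℝ) (k : ℕ) (a : ℝ) (n : ℕ) :
    rootWeight (balanced α k a n) = 0 ∨ rootWeight (balanced α k a n) = a := by
  cases k with
  | zero => exact .inl rfl
  | succ k =>
    rw [balanced]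
    split_ifs
    exacts [.inl rfl, .inr rfl]

theorem isHSBT_balanced {α : ℝ} (hα : 1 < α) (k : ℕ) {a : ℝ} (ha : 0 < a) (n : ℕ) :
    IsHSBT α (balanced α k a n) := by
  have hα0 : 0 < α := one_pos.trans hα
  induction k generalizing a n with
  | zero => trivial
  | succ k ih =>
    rw [balanced]
    split_ifs
    · trivial
    · have key : ∀ m, rootWeight (balanced α k (a / α) m) < a ∧
          α * rootWeight (balanced α k (a / α) m) ≤ a := fun m => by
        rcases rootWeight_balanced α k (a / α) m with h | h <;> rw [h]
        · simpa using ⟨ha, ha.le⟩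
        · exact ⟨div_lt_self ha hα, (mul_div_cancel₀ a hα0.ne').le⟩
      exact ⟨key _, key _, ih (by positivity) _, ih (by positivity) _⟩

theorem weight_balanced_pos {α : ℝ} (hα : 0 < α) (k : ℕ) {a : ℝ} (ha : 0 < a) (n : ℕ)
    (v : Inner (balanced α k a n)) : 0 < weight v := by
  induction k generalizing a n with
  | zero => exact nomatch v
  | succ k ih =>
    revert v
    rcases le_or_gt n 1 with h | h
    · rw [balanced_of_le α k a h]
      exact fun v => nomatch v
    · rw [balanced_of_lt α k a h]
      rintro (_ | v | v)
      exacts [ha, ih (by positivity) _ v, ih (by positivity) _ v]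

/-- There are `n - 1` internal vertices, each at depth less than `k` and hence of weight at least `a
/ α ^ k`. -/
theorem sum_weight_balanced {α : ℝ} (hα : 1 ≤ α) {k : ℕ} {a : ℝ} (ha : 0 < a) {n : ℕ} (h1 : 1 ≤ n)
    (hn : n ≤ 2 ^ k) : (n - 1) * (a / α ^ k) ≤ ∑ v : Inner (balanced α k a n), weight v := by
  induction k generalizing a n with
  | zero =>
    obtain rfl : n = 1 := by simp at hn; omega
    rw [balanced, sum_weight_nil]
    simp
  | succ k ih =>
    have hα0 : 0 < α := one_pos.trans_le hα
    rcases le_or_gt n 1 with h | h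
    · obtain rfl : n = 1 := by omega
      rw [balanced_of_le α k a h, sum_weight_nil]
      simp
    · rw [pow_succ 2] at hn
      have hl := ih (a := a / α) (by positivity) (n := n / 2) (by omega) (by omega)
      have hr := ih (a := a / α) (by positivity) (n := n - n / 2) (by omega) (by omega)
      have hx : a / α ^ (k + 1) ≤ a := div_le_self ha.le (one_le_pow₀ hα)
      rw [div_div, ← pow_succ'] at hl hr
      rw [Nat.cast_sub (by omega)] at hr
      rw [balanced_of_lt α k a h, Inner.sum_node]
      simp only [weight]
      linarith

end StiltWalker

/-! ### The choice of the separation factor and the conclusion -/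

theorem pow_clog_le {κ : ℝ} (hκ : 0 < κ) {n : ℕ} (hn : 2 ≤ n) :
    (1 + κ / Real.log n) ^ Nat.clog 2 n ≤ Real.exp (2 * κ / Real.log 2) := by
  have h2 : 0 < Real.log 2 := Real.log_pos one_lt_two
  have hln : Real.log 2 ≤ Real.log n := Real.log_le_log two_pos (by exact_mod_cast hn)
  -- The rounded-up logarithm is at most `log₂ n + 1`, and `1 ≤ log₂ n` because `n ≥ 2`.
  have hk : (Nat.clog 2 n : ℝ) * Real.log 2 ≤ 2 * Real.log n := by
    have h1 : 2 ^ (Nat.clog 2 n - 1) < n := Nat.pow_pred_clog_lt_self one_lt_two hn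
    have h3 : 0 < Nat.clog 2 n := Nat.clog_pos one_lt_two hn
    have h4 := Real.log_le_log (by positivity)
      (show (2 : ℝ) ^ (Nat.clog 2 n - 1) ≤ n by exact_mod_cast h1.le)
    rw [Real.log_pow, Nat.cast_sub h3] at h4
    push_cast at h4
    linarith
  calc (1 + κ / Real.log n) ^ Nat.clog 2 n
      ≤ Real.exp (κ / Real.log n) ^ Nat.clog 2 n := by
        have := h2.trans_le hln
        gcongr
        linarith [Real.add_one_le_exp (κ / Real.log n)]
    _ = Real.exp (Nat.clog 2 n * (κ / Real.log n)) := (Real.exp_nat_mul _ _).symm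
    _ ≤ _ := by
        rw [Real.exp_le_exp, mul_div_assoc', div_le_div_iff₀ (h2.trans_le hln) h2]
        nlinarith

theorem mainTheorem4 :
    ∀ κ : ℝ, 0 < κ → ∃ c : ℝ, 0 < c ∧ ∀ n : ℕ, 2 ≤ n →
      ((c * n : ℝ) : EReal) ≤
        StiltWalker.competitiveRatio
          {T : BinaryTree ℝ | Fintype.card (StiltWalker.Leaf T) = n ∧
            StiltWalker.IsHSBT (1 + κ / Real.log n) T} := by
  intro κ hκ
  -- One factor 2 comes from `n - 1 ≥ n / 2`, the other from root weight plus one being at most 2;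
  -- the exponential bounds `α` to the depth.
  refine ⟨(4 * Real.exp (2 * κ / Real.log 2))⁻¹, by positivity, fun n hn => ?_⟩
  refine le_sInf ?_
  rintro _ ⟨ρ, hρ, rfl⟩
  rw [EReal.coe_le_coe_iff]
  have hn2 : (2 : ℝ) ≤ n := by exact_mod_cast hn
  have hlog : 0 < Real.log n := Real.log_pos (by linarith)
  have hα : 1 < 1 + κ / Real.log n := by linarith [div_pos hκ hlog]
  have hpow := pow_clog_le hκ hn
  have hnk : n ≤ 2 ^ Nat.clog 2 n := Nat.le_pow_clog one_lt_two n
  set α := 1 + κ / Real.log n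
  have hα0 : 0 < α := one_pos.trans hα
  have hT := StiltWalker.sum_weight_le_of_isCompetitiveOn hρ
    (T := StiltWalker.balanced α (Nat.clog 2 n) 1 n)
    ⟨StiltWalker.card_leaf_balanced α 1 (by omega) hnk,
      StiltWalker.isHSBT_balanced hα _ one_pos n⟩
    (StiltWalker.weight_balanced_pos hα0 _ one_pos n)
  have hsum := StiltWalker.sum_weight_balanced hα.le one_pos (by omega) hnk
  have hroot : StiltWalker.rootWeight (StiltWalker.balanced α (Nat.clog 2 n) 1 n) ≤ 1 := by
    rcases StiltWalker.rootWeight_balanced α (Nat.clog 2 n) 1 n with h | h <;> rw [h]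
    exact zero_le_one
  have hinv : (Real.exp (2 * κ / Real.log 2))⁻¹ ≤ 1 / α ^ Nat.clog 2 n := by
    rw [one_div]
    exact inv_anti₀ (by positivity) hpow
  have hpos : 0 < (Real.exp (2 * κ / Real.log 2))⁻¹ := by positivity
  have h1 : (n - 1) * (Real.exp (2 * κ / Real.log 2))⁻¹ ≤ max ρ 0 * 2 := by
    refine (mul_le_mul_of_nonneg_left hinv (by linarith)).trans (hsum.trans (hT.trans ?_))
    exact mul_le_mul_of_nonneg_left (by linarith) (le_max_right _ _)
  have h2 : n * (Real.exp (2 * κ / Real.log 2))⁻¹ ≤ 4 * max ρ 0 := by nlinarith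
  rw [mul_inv]
  -- If the maximum is `0`, then `h2` bounds a positive number by `0`, which is absurd.
  rcases max_choice ρ 0 with h | h <;> rw [h] at h2
  · linarith
  · nlinarith

end
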